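/- For $x\in\mathbb Z^k$ and $i_1,\dots,i_m\in[k]$, the cyclic statistic of order $m$ is $S_{i_1,\dots,i_m}(x)=\sum_{j=1}^{k}x_{i_1+j}\cdots x_{i_m+j}$ (indices mod $k$). Two sequences are cyclically distinct if neither is a cyclic shift of the other. For $p\in(0,1)$, the circular deletion channel with deletion probability $p$ deletes each bit of a binary string independently with probability $p$ and outputs a uniformly random cyclic shift of what remains (a trace). An algorithm using $T$ traces is an arbitrary (possibly randomized, computationally unrestricted) map from $T$ independent traces to a binary string. It distinguishes $u$ from $v$ if it returns $u$ with probability at least $2/3$ whenever the traces come from a cyclic shift of $u$, and returns $v$ with probability at least $2/3$ whenever they come from a cyclic shift of $v$. It solves circular trace reconstruction for length $N$ if, for every $u\in\{0,1\}^N$, given traces of $u$ it returns a cyclic shift of $u$ with probability at least $2/3$. Let $x=(0,2,3,2,1,1,1,1,2,3,2,0)$ and $y=3-x$ (entrywise), so $k=12$. Then: 1. $y$ is a permutation of $x$; $x$ and $y$ are cyclically distinct; and $S_{i_1,\dots,i_m}(x)=S_{i_1,\dots,i_m}(y)$ for all $m\le 4$ and all $i_1,\dots,i_m\in[12]$. 2.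 For every $n\ge 0$ the strings $X_n=10^{n+x_1}10^{n+x_2}\cdots10^{n+x_{12}}$ and $Y_n=10^{n+y_1}10^{n+y_2}\cdots10^{n+y_{12}}$ both have length $12n+30$ and are not cyclic shifts of each other. For every $p\in(0,1)$ there are $c>0$ and $n_0$, depending only on $p$, such that for all $n\ge n_0$ every algorithm that distinguishes $X_n$ from $Y_n$ uses at least $c\,n^5/\log^5 n$ traces. 3. Consequently, for every $p\in(0,1)$ there are $c>0$ and $N_0$, depending only on $p$, such that for all $N\ge N_0$ of the form $N=12n+30$ every algorithm that solves circular trace reconstruction for length $N$ uses at least $c\,N^5/\log^5 N$ traces; that is, circular trace reconstruction requires $\tilde\Omega(N^5)$ traces in the worst case. -/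

import Mathlib

namespace CircularTrace

/-! ### Integer sequences indexed cyclically

A sequence `(x₁, …, x_k)` is a function on `Fin k`; addition in `Fin k` is addition mod `k`. -/

/-- `y` is a cyclic shift of `x`: there is `c` with `x_j = y_{j+c}` for all `j`, indices mod `k`. -/
def IsCyclicShift {k : ℕ} [NeZero k] (x y : Fin k → ℤ) : Prop :=
  ∃ c : Fin k, ∀ j : Fin k, x j = y (j + c)

/-- `x` and `y` are cyclically distinct. -/
def CyclicallyDistinct {k : ℕ} [NeZero k] (x y : Fin k → ℤ) : Prop :=
  ¬ IsCyclicShift x y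

/-- `y` is a permutation (rearrangement) of `x`. -/
def IsPermutationOf {k : ℕ} (y x : Fin k → ℤ) : Prop :=
  ∃ σ : Equiv.Perm (Fin k), ∀ j : Fin k, y j = x (σ j)

/-- The cyclic statistic `S_{i₁,…,i_m}(x) = ∑_j x_{i₁+j} ⋯ x_{i_m+j}`, indices mod `k`. -/
def cyclicStat {k m : ℕ} [NeZero k] (i : Fin m → Fin k) (x : Fin k → ℤ) : ℤ :=
  ∑ j : Fin k, ∏ r : Fin m, x (i r + j)

/-- `x` and `y` have identical cyclic statistics up to order `M`. -/
def SameCyclicStats {k : ℕ} [NeZero k] (M : ℕ) (x y : Fin k → ℤ) : Prop :=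
  ∀ m : ℕ, m ≤ M → ∀ i : Fin m → Fin k, cyclicStat i x = cyclicStat i y

/-- The sequence `(0,2,3,2,1,1,1,1,2,3,2,0)`. -/
def xSeq : Fin 12 → ℤ := ![0, 2, 3, 2, 1, 1, 1, 1, 2, 3, 2, 0]

/-- The sequence `3 - x`. -/
def ySeq : Fin 12 → ℤ := fun j => 3 - xSeq j

/-! ### Binary strings (`true` is `1`, `false` is `0`); `List.IsRotated` is "is a cyclic shift of" -/

/-- The binary string `1 0^{g₁} 1 0^{g₂} ⋯ 1 0^{g_k}`. -/
def gapString {k : ℕ} (g : Fin k → ℕ) : List Bool :=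
  (List.ofFn fun j => true :: List.replicate (g j) false).flatten

/-- The binary string `1 0^{n+x₁} 1 0^{n+x₂} ⋯ 1 0^{n+x_k}` (meaningful if all `n + x_j ≥ 0`). -/
def shiftedString {k : ℕ} (n : ℕ) (x : Fin k → ℤ) : List Bool :=
  gapString fun j => ((n : ℤ) + x j).toNat

/-! ### The circular deletion channel -/

/-- A coin with `P[true] = p` and `P[false] = 1 - p`. -/
noncomputable def coin (p : unitInterval) : PMF Bool :=
  PMF.ofFintype
    (fun b => if b then ENNReal.ofReal (p : ℝ) else ENNReal.ofReal (1 - (p : ℝ))) (by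
      simp only [Fintype.sum_bool, if_true, Bool.false_eq_true, if_false]
      rw [← ENNReal.ofReal_add p.2.1 (sub_nonneg.2 p.2.2)]
      simp)

/-- Delete each bit independently with probability `p`. -/
noncomputable def deletion (p : unitInterval) : List Bool → PMF (List Bool)
  | [] => PMF.pure []
  | b :: l =>
      (coin p).bind fun deleted =>
        (deletion p l).map fun t => if deleted then t else b :: t

/-- A uniformly random cyclic shift of a string. -/
noncomputable def randomShift : List Bool → PMF (List Bool)
  | [] => PMF.pure []
  | b :: l => (PMF.uniformOfFintype (Fin (l.length + 1))).map fun r => (b :: l).rotate r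

/-- The circular deletion channel with deletion probability `p`: the law of a trace of `x`. -/
noncomputable def circDel (p : unitInterval) (x : List Bool) : PMF (List Bool) :=
  (deletion p x).bind randomShift

/-- The law of `T` independent samples from `μ`. -/
noncomputable def iid {α : Type} (μ : PMF α) : (T : ℕ) → PMF (Fin T → α)
  | 0 => PMF.pure Fin.elim0
  | T + 1 => μ.bind fun a => (iid μ T).map fun s => (Fin.cons a s : Fin (T + 1) → α)

/-! ### Algorithms using `T` traces -/

/-- A (randomized) algorithm that receives `T` traces and outputs a binary string: to every tuple
of traces it assigns the law of its output. No computational restriction is imposed. -/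
def Algorithm (T : ℕ) : Type := (Fin T → List Bool) → PMF (List Bool)

/-- The law of the output of `A` when its `T` traces are drawn independently from the circular
deletion channel applied to `z`. -/
noncomputable def Algorithm.output {T : ℕ} (A : Algorithm T) (p : unitInterval) (z : List Bool) :
    PMF (List Bool) :=
  (iid (circDel p z) T).bind A

/-- `A` distinguishes `x` from `y`: on input `z`, it returns `x` with probability at least `2/3`
if `x` is a cyclic shift of `z`, and returns `y` with probability at least `2/3` if `y` is. -/
def Distinguishes {T : ℕ} (A : Algorithm T) (p : unitInterval) (x y : List Bool) : Prop :=
  ∀ z : List Bool,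
    (x.IsRotated z → 2 / 3 ≤ A.output p z x) ∧ (y.IsRotated z → 2 / 3 ≤ A.output p z y)

/-- `A` solves the circular trace reconstruction problem for strings of length `N`: for every
string `x` of length `N`, with probability at least `2/3` the output is a cyclic shift of `x`. -/
def SolvesReconstruction {T : ℕ} (A : Algorithm T) (p : unitInterval) (N : ℕ) : Prop :=
  ∀ x : List Bool, x.length = N →
    2 / 3 ≤ (A.output p x).toOuterMeasure {w | w.IsRotated x}

end CircularTrace

open scoped ENNReal

namespace CircularTrace

/-! A trace depends on the string only through the numbers of zeros that survive in the gaps, read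
up to a random cyclic relabelling: given these, deleting the ones and rotating is a kernel that does
not know the string (`circDel_gapString`). Hellinger affinity does not decrease under kernels and is
multiplicative over independent samples, so `T` traces can separate the two strings only if the
`T`-th power of the affinity of the two gap laws is bounded away from one
(`affinity_gapMixture_pow_le`).

The gap laws are mixtures over `c` of products of binomial probabilities. Put `ε = √(log n / n)`. At
outcomes within `O(nε)` of the mean, the probability for `n + x` trials is that for `n + 3` trials
times a cubic in `3 - x` whose coefficient of degree `s` is `O(ε^s)` (`survivorProb_expansion`).
Expanding the product over the gaps and averaging over `c` gives cyclic statistics of `3 - x`, those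
of order `m` weighted by `O(ε^m)`. Orders up to four agree for the two sequences, so the densities
differ by a relative `O(ε^5)` (`exists_gapMixture_close`).

Outcomes away from the mean have mass `O(ε^10)` by a Chernoff bound, and affinity loses only the
square of the relative error, so it is at least `1 - O(ε^10)` (`le_affinity_gapMixture`). Hence `T`
is at least a constant times `ε^(-10) = n^5 / log^5 n`. The combinatorial facts about the two
sequences are finite computations. -/

/-! ### Hellinger affinity and data processing -/

/-- The Hellinger affinity (Bhattacharyya coefficient) of two discrete distributions. -/
noncomputable def affinity {α : Type*} (μ ν : PMF α) : ℝ≥0∞ :=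
  ∑' a, (μ a * ν a) ^ (1 / 2 : ℝ)

lemma sqrt_mul_self_ennreal (a : ℝ≥0∞) : (a * a) ^ (1 / 2 : ℝ) = a := by
  rw [← pow_two, ← ENNReal.rpow_natCast, ← ENNReal.rpow_mul]
  norm_num

/-- The Cauchy–Schwarz inequality for sums of extended nonnegative reals. -/
lemma tsum_sqrt_mul_le {α : Type*} (f g : α → ℝ≥0∞) :
    ∑' a, (f a * g a) ^ (1 / 2 : ℝ) ≤ ((∑' a, f a) * ∑' a, g a) ^ (1 / 2 : ℝ) := by
  rw [ENNReal.tsum_eq_iSup_sum]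
  refine iSup_le fun s => ?_
  have h := ENNReal.inner_le_Lp_mul_Lq s (fun a => f a ^ (1 / 2 : ℝ))
    (fun a => g a ^ (1 / 2 : ℝ)) Real.HolderConjugate.two_two
  simp only [← ENNReal.rpow_mul] at h
  norm_num at h
  calc ∑ a ∈ s, (f a * g a) ^ (1 / 2 : ℝ)
      = ∑ a ∈ s, f a ^ (1 / 2 : ℝ) * g a ^ (1 / 2 : ℝ) := by
        refine Finset.sum_congr rfl fun a _ => ?_
        rw [ENNReal.mul_rpow_of_nonneg _ _ (by norm_num)]
    _ ≤ (∑ a ∈ s, f a) ^ (1 / 2 : ℝ) * (∑ a ∈ s, g a) ^ (1 / 2 : ℝ) := h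
    _ ≤ (∑' a, f a) ^ (1 / 2 : ℝ) * (∑' a, g a) ^ (1 / 2 : ℝ) := by
        gcongr <;> exact ENNReal.sum_le_tsum s
    _ = _ := by rw [ENNReal.mul_rpow_of_nonneg _ _ (by norm_num)]

/-- Data processing: a common randomized map does not decrease the affinity. -/
lemma affinity_le_affinity_bind {α β : Type*} (μ ν : PMF α) (K : α → PMF β) :
    affinity μ ν ≤ affinity (μ.bind K) (ν.bind K) := by
  unfold affinity
  calc ∑' a, (μ a * ν a) ^ (1 / 2 : ℝ)
      = ∑' a, ∑' b, (μ a * ν a) ^ (1 / 2 : ℝ) * K a b := by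
        refine tsum_congr fun a => ?_
        rw [ENNReal.tsum_mul_left, (K a).tsum_coe, mul_one]
    _ = ∑' b, ∑' a, (μ a * K a b * (ν a * K a b)) ^ (1 / 2 : ℝ) := by
        rw [ENNReal.tsum_comm]
        refine tsum_congr fun b => tsum_congr fun a => ?_
        rw [mul_mul_mul_comm, ENNReal.mul_rpow_of_nonneg (μ a * ν a) _ (by norm_num),
          sqrt_mul_self_ennreal]
    -- Cauchy–Schwarz over `a`, separately for each output `b`.
    _ ≤ _ := ENNReal.tsum_le_tsum fun b => by
        simp only [PMF.bind_apply]
        exact tsum_sqrt_mul_le _ _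

/-! ### Product laws and tensorization of the affinity -/

lemma tsum_pi_prod {α : Type*} : ∀ {k : ℕ} (f : Fin k → α → ℝ≥0∞),
    ∑' s : Fin k → α, ∏ i, f i (s i) = ∏ i, ∑' a, f i a
  | 0, f => by simp
  | k + 1, f => by
      rw [Fin.prod_univ_succ, ← tsum_pi_prod (fun i => f i.succ),
        ← (Fin.consEquiv fun _ : Fin (k + 1) => α).tsum_eq, ENNReal.tsum_prod',
        ← ENNReal.tsum_mul_right]
      refine tsum_congr fun a => ?_
      rw [← ENNReal.tsum_mul_left]
      refine tsum_congr fun s => ?_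
      simp [Fin.consEquiv, Fin.prod_univ_succ]

/-- The law of independent samples from the given laws. -/
noncomputable def productLaw {α : Type*} {k : ℕ} (μ : Fin k → PMF α) : PMF (Fin k → α) :=
  ⟨fun s => ∏ i, μ i (s i), by
    have h := tsum_pi_prod fun i => (μ i : α → ℝ≥0∞)
    simp only [PMF.tsum_coe, Finset.prod_const_one] at h
    exact h ▸ ENNReal.summable.hasSum⟩

lemma productLaw_apply {α : Type*} {k : ℕ} (μ : Fin k → PMF α) (s : Fin k → α) :
    productLaw μ s = ∏ i, μ i (s i) := rfl

lemma bind_map_cons_apply {α : Type*} {k : ℕ} (μ : PMF α) (ν : PMF (Fin k → α))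
    (s : Fin (k + 1) → α) :
    (μ.bind fun a => ν.map fun t => (Fin.cons a t : Fin (k + 1) → α)) s
      = μ (s 0) * ν (Fin.tail s) := by
  classical
  rw [PMF.bind_apply, tsum_eq_single (s 0)]
  · rw [PMF.map_apply, tsum_eq_single (Fin.tail s)]
    · simp
    · intro t ht
      refine if_neg fun h => ht ?_
      rw [h, Fin.tail_cons]
  · intro a ha
    rw [PMF.map_apply]
    refine mul_eq_zero_of_right _ (ENNReal.tsum_eq_zero.2 fun t => if_neg fun h => ha ?_)
    rw [h, Fin.cons_zero]

lemma productLaw_succ {α : Type*} {k : ℕ} (μ : Fin (k + 1) → PMF α) :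
    productLaw μ = (μ 0).bind fun a =>
      (productLaw fun i => μ i.succ).map fun t => (Fin.cons a t : Fin (k + 1) → α) := by
  ext s
  rw [bind_map_cons_apply, productLaw_apply, productLaw_apply, Fin.prod_univ_succ]
  rfl

lemma iid_eq_productLaw {α : Type} (μ : PMF α) : ∀ T : ℕ, iid μ T = productLaw fun _ => μ
  | 0 => by
      ext s
      rw [Subsingleton.elim s Fin.elim0]
      simp [iid, productLaw_apply]
  | T + 1 => by rw [productLaw_succ, iid, iid_eq_productLaw μ T]

lemma affinity_iid {α : Type} (μ ν : PMF α) (T : ℕ) :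
    affinity (iid μ T) (iid ν T) = affinity μ ν ^ T := by
  have h := tsum_pi_prod fun (_ : Fin T) a => (μ a * ν a) ^ (1 / 2 : ℝ)
  rw [Finset.prod_const, Finset.card_univ, Fintype.card_fin] at h
  rw [affinity, affinity, ← h]
  refine tsum_congr fun s => ?_
  rw [iid_eq_productLaw, iid_eq_productLaw, productLaw_apply, productLaw_apply,
    ← Finset.prod_mul_distrib, ENNReal.prod_rpow_of_nonneg (by norm_num)]

/-! ### Affinity against tests and against density ratios -/

/-- Young's inequality in the form `√(uv) ≤ cu + dv` for `4cd = 1`. -/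
lemma sqrt_mul_le_ennreal {c d : ℝ} (hc : 0 ≤ c) (hd : 0 ≤ d) (h : 4 * (c * d) = 1)
    {u v : ℝ≥0∞} (hu : u ≠ ∞) (hv : v ≠ ∞) :
    (u * v) ^ (1 / 2 : ℝ) ≤ ENNReal.ofReal c * u + ENNReal.ofReal d * v := by
  lift u to NNReal using hu
  lift v to NNReal using hv
  lift c to NNReal using hc
  lift d to NNReal using hd
  rw [ENNReal.ofReal_coe_nnreal, ENNReal.ofReal_coe_nnreal, one_div, ENNReal.rpow_inv_le_iff
    (by norm_num)]
  norm_cast at h ⊢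
  rw [← NNReal.coe_le_coe]
  have h' : 4 * ((c : ℝ) * d) = 1 := by exact_mod_cast h
  push_cast
  have := sq_nonneg ((c : ℝ) * u - d * v)
  nlinarith [mul_nonneg u.2 v.2, congrArg (· * ((u : ℝ) * v)) h']

/-- Two laws told apart by an event are not close. -/
lemma affinity_le_of_test {α : Type*} (μ ν : PMF α) (E : Set α)
    (hμ : 2 / 3 ≤ μ.toOuterMeasure E) (hν : ν.toOuterMeasure E ≤ 1 / 3) :
    affinity μ ν ≤ ENNReal.ofReal (17 / 18) := by
  classical
  have split (ξ : PMF α) : ξ.toOuterMeasure E + ∑' a, Eᶜ.indicator ξ a = 1 := by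
    rw [PMF.toOuterMeasure_apply, ← ENNReal.tsum_add, ← ξ.tsum_coe]
    exact tsum_congr fun a => Set.indicator_self_add_compl_apply E ξ a
  have hμ1 := split μ
  have hν1 := split ν
  -- The weights `3/8` and `2/3` have `4cd = 1` and are rational substitutes for the optimal `√2/4`
  -- and `√2/2` at masses `2/3` and `1/3`. There the bound equals `2 * (1/4 + 2/9) = 17/18`.
  have key : affinity μ ν ≤
      ENNReal.ofReal (3 / 8) * μ.toOuterMeasure E + ENNReal.ofReal (2 / 3) * ν.toOuterMeasure E
      + (ENNReal.ofReal (2 / 3) * ∑' a, Eᶜ.indicator μ a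
      + ENNReal.ofReal (3 / 8) * ∑' a, Eᶜ.indicator ν a) := by
    simp only [PMF.toOuterMeasure_apply, ← ENNReal.tsum_mul_left, ← ENNReal.tsum_add]
    refine ENNReal.tsum_le_tsum fun a => ?_
    by_cases ha : a ∈ E
    · simpa [ha] using sqrt_mul_le_ennreal (c := 3 / 8) (d := 2 / 3) (by norm_num) (by norm_num)
        (by norm_num) (μ.apply_ne_top a) (ν.apply_ne_top a)
    · simpa [ha] using sqrt_mul_le_ennreal (c := 2 / 3) (d := 3 / 8) (by norm_num) (by norm_num)
        (by norm_num) (μ.apply_ne_top a) (ν.apply_ne_top a)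
  refine key.trans ?_
  generalize μ.toOuterMeasure E = m at *
  generalize ν.toOuterMeasure E = v at *
  generalize ∑' a, Eᶜ.indicator μ a = m' at *
  generalize ∑' a, Eᶜ.indicator ν a = v' at *
  have fin {s t : ℝ≥0∞} (h : s + t = 1) : s ≠ ∞ ∧ t ≠ ∞ :=
    ENNReal.add_ne_top.1 (h ▸ ENNReal.one_ne_top)
  obtain ⟨h1, h2⟩ := fin hμ1
  obtain ⟨h3, h4⟩ := fin hν1
  lift m to NNReal using h1
  lift m' to NNReal using h2
  lift v to NNReal using h3
  lift v' to NNReal using h4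
  have e1 : (m : ℝ) + m' = 1 := by exact_mod_cast hμ1
  have e2 : (v : ℝ) + v' = 1 := by exact_mod_cast hν1
  have i1 : (2 / 3 : ℝ) ≤ m := by
    have := ENNReal.toReal_mono (by simp) hμ
    simpa using this
  have i2 : (v : ℝ) ≤ 1 / 3 := by
    have := ENNReal.toReal_mono (by simp) hν
    simpa using this
  simp only [← ENNReal.ofReal_coe_nnreal]
  rw [← ENNReal.ofReal_mul (by norm_num), ← ENNReal.ofReal_mul (by norm_num),
    ← ENNReal.ofReal_mul (by norm_num), ← ENNReal.ofReal_mul (by norm_num),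
    ← ENNReal.ofReal_add (by positivity) (by positivity),
    ← ENNReal.ofReal_add (by positivity) (by positivity),
    ← ENNReal.ofReal_add (by positivity) (by positivity)]
  refine ENNReal.ofReal_le_ofReal ?_
  linarith

/-- Two laws with nearly equal densities off a small set have affinity close to one. -/
lemma le_affinity {α : Type*} (μ ν : PMF α) (S : Set α) {η τ : ℝ} (hη : η ^ 2 ≤ 1)
    (hτ : 0 ≤ τ)
    (h : ∀ a ∈ S, |(μ a).toReal - (ν a).toReal| ≤ η * ((μ a).toReal + (ν a).toReal))
    (hμ : μ.toOuterMeasure Sᶜ ≤ ENNReal.ofReal τ) (hν : ν.toOuterMeasure Sᶜ ≤ ENNReal.ofReal τ) :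
    ENNReal.ofReal (1 - (η ^ 2 + τ)) ≤ affinity μ ν := by
  classical
  have half : ENNReal.ofReal (1 / 2) + ENNReal.ofReal (1 / 2) = 1 := by
    rw [← ENNReal.ofReal_add (by norm_num) (by norm_num)]; norm_num
  have one : (1 : ℝ≥0∞) = ∑' a, ENNReal.ofReal (1 / 2) * (μ a + ν a) := by
    rw [ENNReal.tsum_mul_left, ENNReal.tsum_add, μ.tsum_coe, ν.tsum_coe, mul_add, mul_one, half]
  have point (a : α) : ENNReal.ofReal (1 / 2) * (μ a + ν a) ≤ (μ a * ν a) ^ (1 / 2 : ℝ)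
      + ENNReal.ofReal (η ^ 2) * (ENNReal.ofReal (1 / 2) * (μ a + ν a))
      + ENNReal.ofReal (1 / 2) * (Sᶜ.indicator μ a + Sᶜ.indicator ν a) := by
    by_cases ha : a ∈ S
    · have := h a ha
      have hu := μ.apply_ne_top a
      have hv := ν.apply_ne_top a
      simp only [Set.mem_compl_iff, ha, not_true, not_false_eq_true, Set.indicator_of_notMem,
        add_zero, mul_zero]
      generalize μ a = u at *
      generalize ν a = v at *
      lift u to NNReal using hu
      lift v to NNReal using hv
      simp only [ENNReal.coe_toReal] at this
      have hu0 : (0 : ℝ) ≤ u := u.2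
      have hv0 : (0 : ℝ) ≤ v := v.2
      simp only [← ENNReal.ofReal_coe_nnreal]
      rw [← ENNReal.ofReal_mul hu0, ← ENNReal.ofReal_add hu0 hv0,
        ENNReal.ofReal_rpow_of_nonneg (by positivity) (by norm_num),
        ← ENNReal.ofReal_mul (by norm_num), ← ENNReal.ofReal_mul (by positivity),
        ← ENNReal.ofReal_add (by positivity) (by positivity)]
      refine ENNReal.ofReal_le_ofReal ?_
      rw [← Real.sqrt_eq_rpow]
      -- From `4uv = (u + v)² - (u - v)² ≥ (1 - η²)(u + v)²`, using `√(1 - η²) ≥ 1 - η²`. The loss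
      -- is quadratic in `η`.
      have : (1 - η ^ 2) * ((u + v) / 2 : ℝ) ≤ √(u * v) := by
        refine Real.le_sqrt_of_sq_le ?_
        have h2 : ((u : ℝ) - v) ^ 2 ≤ η ^ 2 * (u + v) ^ 2 := by
          rw [← mul_pow, ← sq_abs]
          exact pow_le_pow_left₀ (abs_nonneg _) this 2
        have h3 : (1 - η ^ 2) ^ 2 ≤ 1 - η ^ 2 := by nlinarith [sq_nonneg η]
        nlinarith [mul_le_mul_of_nonneg_right h3 (sq_nonneg ((u : ℝ) + v))]
      linarith
    · simp only [Set.mem_compl_iff, ha, not_false_eq_true, Set.indicator_of_mem]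
      exact le_add_self
  have total : (1 : ℝ≥0∞) ≤ affinity μ ν + ENNReal.ofReal (η ^ 2) + ENNReal.ofReal τ := by
    calc (1 : ℝ≥0∞) = _ := one
      _ ≤ _ := ENNReal.tsum_le_tsum point
      _ = affinity μ ν + ENNReal.ofReal (η ^ 2) + ENNReal.ofReal (1 / 2) *
            (μ.toOuterMeasure Sᶜ + ν.toOuterMeasure Sᶜ) := by
          rw [ENNReal.tsum_add, ENNReal.tsum_add, ENNReal.tsum_mul_left, ← one, mul_one,
            ENNReal.tsum_mul_left, ENNReal.tsum_add, PMF.toOuterMeasure_apply,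
            PMF.toOuterMeasure_apply, affinity]
      _ ≤ affinity μ ν + ENNReal.ofReal (η ^ 2) + ENNReal.ofReal (1 / 2) *
            (ENNReal.ofReal τ + ENNReal.ofReal τ) := by gcongr
      _ = _ := by rw [mul_add, ← add_mul, half, one_mul]
  rw [ENNReal.ofReal_sub _ (by positivity), ENNReal.ofReal_one, tsub_le_iff_right,
    ENNReal.ofReal_add (sq_nonneg η) hτ, ← add_assoc]
  exact total

/-! ### Factoring the channel through the vector of thinned gaps -/

lemma deletion_append (p : unitInterval) (l m : List Bool) :
    deletion p (l ++ m) = (deletion p l).bind fun s => (deletion p m).map fun t => s ++ t := by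
  induction l with
  | nil => simp [deletion, show (fun t : List Bool => t) = id from rfl, PMF.map_id]
  | cons b l ih =>
    simp only [List.cons_append, deletion, ih, ← PMF.bind_pure_comp, PMF.bind_bind,
      Function.comp_def, PMF.pure_bind]
    refine congrArg _ (funext fun d => congrArg _ (funext fun s => congrArg _ (funext fun t => ?_)))
    cases d <;> simp

/-- The law of the number of bits, out of `g`, that survive the deletions. -/
noncomputable def survivorLaw (p : unitInterval) : ℕ → PMF ℕ
  | 0 => PMF.pure 0
  | g + 1 => (coin p).bind fun deleted =>
      (survivorLaw p g).map fun a => if deleted then a else a + 1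

lemma deletion_replicate (p : unitInterval) (b : Bool) (g : ℕ) :
    deletion p (List.replicate g b) = (survivorLaw p g).map fun a => List.replicate a b := by
  induction g with
  | zero => simp [deletion, survivorLaw, PMF.pure_map]
  | succ g ih =>
    simp only [List.replicate_succ, deletion, ih, survivorLaw, ← PMF.bind_pure_comp,
      PMF.bind_bind, Function.comp_def, PMF.pure_bind]
    refine congrArg _ (funext fun d => congrArg _ (funext fun s => ?_))
    cases d <;> simp [List.replicate_succ]

lemma gapString_zero (g : Fin 0 → ℕ) : gapString g = [] := by simp [gapString]

lemma gapString_succ {k : ℕ} (g : Fin (k + 1) → ℕ) :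
    gapString g = [true] ++ (List.replicate (g 0) false ++ gapString (Fin.tail g)) := by
  simp [gapString, List.ofFn_succ, Fin.tail]

/-- Delete ones only from the string with the given gaps. -/
noncomputable def deleteOnes (p : unitInterval) : {k : ℕ} → (Fin k → ℕ) → PMF (List Bool)
  | 0, _ => PMF.pure []
  | _ + 1, a => (deletion p [true]).bind fun s =>
      (deleteOnes p (Fin.tail a)).map fun t => s ++ (List.replicate (a 0) false ++ t)

/-- Zeros and ones are deleted independently, so all zeros may be thinned before any one is touched.
What remains is a kernel that sees only the thinned gaps. -/
lemma deletion_gapString (p : unitInterval) : ∀ {k : ℕ} (g : Fin k → ℕ),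
    deletion p (gapString g) = (productLaw fun i => survivorLaw p (g i)).bind (deleteOnes p)
  | 0, g => by
      rw [gapString_zero]
      simp [deletion, deleteOnes]
  | k + 1, g => by
      rw [gapString_succ, deletion_append, deletion_append, deletion_gapString p (Fin.tail g),
        deletion_replicate, productLaw_succ]
      simp only [deleteOnes, ← PMF.bind_pure_comp, PMF.bind_bind, Function.comp_def,
        PMF.pure_bind, Fin.cons_zero, Fin.tail_cons, Fin.tail]
      rw [PMF.bind_comm]
      refine congrArg _ (funext fun a => ?_)
      rw [PMF.bind_comm]

/-! ### Invariance under rotation -/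

lemma map_uniformOfFintype_equiv {α : Type*} [Fintype α] [Nonempty α] (e : α ≃ α) :
    (PMF.uniformOfFintype α).map e = PMF.uniformOfFintype α := by
  classical
  ext b
  rw [PMF.map_apply, tsum_eq_single (e.symm b)]
  · simp
  · intro a ha
    refine if_neg fun h => ha ?_
    rw [h, e.symm_apply_apply]

lemma randomShift_eq_map {n : ℕ} (w : List Bool) (h : w.length = n + 1) :
    randomShift w = (PMF.uniformOfFintype (Fin (n + 1))).map fun r : Fin (n + 1) => w.rotate r := by
  cases w with
  | nil => simp at h
  | cons b l =>
    obtain rfl : l.length = n := by simpa using h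
    -- `randomShift` unfolds to a law whose shift amount is first pushed to `ℕ` by a `bind`; this
    -- coercion is absorbed into the `map`.
    change (((PMF.uniformOfFintype (Fin (l.length + 1))).bind fun r => PMF.pure (r : ℕ)).map
      fun r => (b :: l).rotate r) = _
    simp only [← PMF.bind_pure_comp, PMF.bind_bind, Function.comp_def, PMF.pure_bind]

lemma randomShift_rotate (w : List Bool) (m : ℕ) : randomShift (w.rotate m) = randomShift w := by
  rcases Nat.eq_zero_or_pos w.length with h0 | hpos
  · rw [List.length_eq_zero_iff.1 h0, List.rotate_nil]
  · obtain ⟨n, hn⟩ : ∃ n, w.length = n + 1 := ⟨w.length - 1, by omega⟩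
    rw [randomShift_eq_map (n := n) w hn, randomShift_eq_map (n := n) _ (by simp [hn])]
    conv_rhs => rw [← map_uniformOfFintype_equiv (Equiv.addLeft (Fin.ofNat (n + 1) m)),
      PMF.map_comp]
    congr 1
    funext r
    simp only [Function.comp_apply, List.rotate_rotate, Equiv.coe_addLeft, Fin.val_add,
      Fin.val_ofNat, Nat.mod_add_mod]
    have hmod := List.rotate_mod w (m + r)
    rw [hn] at hmod
    exact hmod.symm

/-- The two halves are thinned independently, and exchanging the survivors is a rotation, which the
final uniform shift hides. -/
lemma circDel_append_comm (p : unitInterval) (l m : List Bool) :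
    circDel p (l ++ m) = circDel p (m ++ l) := by
  simp only [circDel, deletion_append, ← PMF.bind_pure_comp, PMF.bind_bind, Function.comp_def,
    PMF.pure_bind]
  rw [PMF.bind_comm]
  refine congrArg _ (funext fun t => congrArg _ (funext fun s => ?_))
  rw [← List.rotate_append_length_eq, randomShift_rotate]

lemma ofFn_add_right {α : Type*} {k : ℕ} [NeZero k] (f : Fin k → α) (c : Fin k) :
    (List.ofFn fun i => f (i + c)) = (List.ofFn f).rotate c := by
  refine List.ext_getElem (by simp) fun i h1 h2 => ?_
  simp only [List.getElem_ofFn, List.getElem_rotate, List.length_ofFn]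
  exact congrArg f (Fin.ext (by simp [Fin.val_add]))

lemma circDel_gapString_add (p : unitInterval) {k : ℕ} [NeZero k] (g : Fin k → ℕ) (c : Fin k) :
    circDel p (gapString fun i => g (i + c)) = circDel p (gapString g) := by
  unfold gapString
  rw [ofFn_add_right (fun i => true :: List.replicate (g i) false) c,
    List.rotate_eq_drop_append_take (by simp), List.flatten_append,
    circDel_append_comm, ← List.flatten_append, List.take_append_drop]

/-- The law of the thinned gaps after a uniformly random cyclic relabelling. -/
noncomputable def gapMixture (p : unitInterval) {k : ℕ} [NeZero k] (g : Fin k → ℕ) :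
    PMF (Fin k → ℕ) :=
  (PMF.uniformOfFintype (Fin k)).bind fun c => productLaw fun i => survivorLaw p (g (i + c))

/-- The channel ignores where the circle is cut, so the gaps may be relabelled at random at no cost.
This averaging is what produces cyclic statistics in the density. -/
lemma circDel_gapString (p : unitInterval) {k : ℕ} [NeZero k] (g : Fin k → ℕ) :
    circDel p (gapString g) =
      (gapMixture p g).bind fun a => (deleteOnes p a).bind randomShift := by
  have h : circDel p (gapString g) = (PMF.uniformOfFintype (Fin k)).bind fun c =>
      circDel p (gapString fun i => g (i + c)) := by
    simp only [circDel_gapString_add, PMF.bind_const]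
  rw [h]
  simp only [gapMixture, circDel, deletion_gapString, PMF.bind_bind]

/-- Any test between two strings with `k` gaps is limited by the affinity of the gap laws. -/
lemma affinity_gapMixture_pow_le (p : unitInterval) {k T : ℕ} [NeZero k] (g h : Fin k → ℕ)
    (A : Algorithm T) (E : Set (List Bool))
    (hg : 2 / 3 ≤ (A.output p (gapString g)).toOuterMeasure E)
    (hh : (A.output p (gapString h)).toOuterMeasure E ≤ 1 / 3) :
    affinity (gapMixture p g) (gapMixture p h) ^ T ≤ ENNReal.ofReal (17 / 18) := by
  refine le_trans ?_ (affinity_le_of_test _ _ E hg hh)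
  refine le_trans ?_ (affinity_le_affinity_bind _ _ A)
  rw [affinity_iid, circDel_gapString, circDel_gapString]
  gcongr
  exact affinity_le_affinity_bind _ _ _

/-! ### Binomial estimates -/

/-- The probability that exactly `a` out of `m` bits survive. -/
noncomputable def survivorProb (p : ℝ) (m a : ℕ) : ℝ := m.choose a * (1 - p) ^ a * p ^ (m - a)

lemma survivorProb_nonneg {p : ℝ} (h0 : 0 ≤ p) (h1 : p ≤ 1) (m a : ℕ) :
    0 ≤ survivorProb p m a := by
  have : 0 ≤ 1 - p := sub_nonneg.2 h1
  unfold survivorProb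
  positivity

lemma survivorProb_succ_succ (p : ℝ) (m a : ℕ) :
    survivorProb p (m + 1) (a + 1) = p * survivorProb p m (a + 1) + (1 - p) * survivorProb p m a := by
  unfold survivorProb
  rw [Nat.choose_succ_succ, Nat.add_sub_add_right]
  rcases lt_or_ge m (a + 1) with h | h
  · rw [Nat.choose_eq_zero_of_lt h]
    push_cast
    ring
  · rw [show m - a = (m - (a + 1)) + 1 by omega]
    push_cast
    ring

/-- Comparing `m` trials with `m + 1`, rather than the reverse, means that only `(m + 1) * p` is
ever divided by, which is positive whatever `a` is. -/
lemma survivorProb_mul_succ (p : ℝ) (m a : ℕ) :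
    survivorProb p m a * ((m + 1 : ℝ) * p) = survivorProb p (m + 1) a * (m + 1 - a : ℝ) := by
  unfold survivorProb
  rcases lt_trichotomy a (m + 1) with h | rfl | h
  · have hc := congrArg (Nat.cast : ℕ → ℝ) (Nat.choose_mul_succ_eq m a)
    push_cast [Nat.cast_sub h.le] at hc
    rw [show m + 1 - a = (m - a) + 1 by omega, pow_succ]
    linear_combination (1 - p) ^ a * p ^ (m - a) * p * hc
  · simp
  · simp [Nat.choose_eq_zero_of_lt h, Nat.choose_eq_zero_of_lt (Nat.lt_of_succ_lt h)]

lemma coin_bind_apply {α : Type*} (p : unitInterval) (f : Bool → PMF α) (a : α) :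
    (coin p).bind f a =
      ENNReal.ofReal p * f true a + ENNReal.ofReal (1 - p) * f false a := by
  rw [PMF.bind_apply, tsum_bool, add_comm]
  simp [coin]

lemma survivorLaw_apply (p : unitInterval) : ∀ m a : ℕ,
    survivorLaw p m a = ENNReal.ofReal (survivorProb p m a)
  | 0, 0 => by simp [survivorLaw, survivorProb]
  | 0, a + 1 => by simp [survivorLaw, survivorProb]
  | m + 1, a => by
      have hp := p.2.1
      have hq : (0 : ℝ) ≤ 1 - p := sub_nonneg.2 p.2.2
      rw [survivorLaw, coin_bind_apply]
      have h1 : ((survivorLaw p m).map fun a => if true = true then a else a + 1)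
          = survivorLaw p m := by
        simp only [if_true]
        exact PMF.map_id _
      rw [h1, survivorLaw_apply p m a, PMF.map_apply, ← ENNReal.ofReal_mul hp]
      cases a with
      | zero =>
        simp [survivorProb, pow_succ, mul_comm]
      | succ a =>
        rw [tsum_eq_single a (by
          intro b hb
          simp [hb.symm])]
        simp only [Bool.false_eq_true, if_false, if_true]
        rw [survivorLaw_apply p m a, ← ENNReal.ofReal_mul hq, ← ENNReal.ofReal_add
          (mul_nonneg hp (survivorProb_nonneg hp p.2.2 _ _))
          (mul_nonneg hq (survivorProb_nonneg hp p.2.2 _ _)), survivorProb_succ_succ]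

lemma tsum_survivorLaw_mul_exp (p : unitInterval) (m : ℕ) (t : ℝ) :
    ∑' a, survivorLaw p m a * ENNReal.ofReal (Real.exp (t * a))
      = ENNReal.ofReal ((p + (1 - p) * Real.exp t) ^ m) := by
  rw [tsum_eq_sum (s := Finset.range (m + 1))]
  · simp only [survivorLaw_apply]
    rw [add_comm (p : ℝ), add_pow, ENNReal.ofReal_sum_of_nonneg]
    · refine Finset.sum_congr rfl fun a _ => ?_
      rw [← ENNReal.ofReal_mul (survivorProb_nonneg p.2.1 p.2.2 _ _), survivorProb, mul_pow,
        ← Real.exp_nat_mul, mul_comm t]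
      congr 1
      ring
    · intro a _
      have hp := p.2.1
      have hq : (0 : ℝ) ≤ 1 - p := sub_nonneg.2 p.2.2
      positivity
  · intro a ha
    rw [Finset.mem_range, not_lt] at ha
    simp [survivorLaw_apply, survivorProb, Nat.choose_eq_zero_of_lt ha]

/-- Apply `exp u ≤ 1 + u + u²`, valid for `|u| ≤ 1`, to the centred Bernoulli variable: the linear
terms cancel and the variance is `p(1 - p) ≤ 1`. -/
lemma mgf_bernoulli_le {p t : ℝ} (h0 : 0 ≤ p) (h1 : p ≤ 1) (ht : |t| ≤ 1) :
    (p + (1 - p) * Real.exp t) * Real.exp (-(t * (1 - p))) ≤ Real.exp (t ^ 2) := by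
  have hq : 0 ≤ 1 - p := sub_nonneg.2 h1
  have hexp (c : ℝ) (hc0 : 0 ≤ c) (hc : c ≤ 1) (s : ℝ) (hs : |s| ≤ 1) :
      Real.exp (s * c) ≤ 1 + s * c + (s * c) ^ 2 := by
    have : |s * c| ≤ 1 := by
      rw [abs_mul, abs_of_nonneg hc0]
      exact mul_le_one₀ hs hc0 hc
    have := (abs_le.1 (Real.abs_exp_sub_one_sub_id_le this)).2
    linarith
  have e1 := hexp (1 - p) hq (by linarith) (-t) (by rwa [abs_neg])
  have e2 := hexp p h0 h1 t ht
  have split : (p + (1 - p) * Real.exp t) * Real.exp (-(t * (1 - p)))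
      = p * Real.exp (-t * (1 - p)) + (1 - p) * Real.exp (t * p) := by
    rw [add_mul, mul_assoc, ← Real.exp_add]
    ring_nf
  rw [split]
  have := mul_le_mul_of_nonneg_left e1 h0
  have := mul_le_mul_of_nonneg_left e2 hq
  have : p * (1 - p) ≤ 1 := by nlinarith
  nlinarith [Real.add_one_le_exp (t ^ 2), mul_le_mul_of_nonneg_right this (sq_nonneg t)]

/-- The exponential Markov inequality for the number of surviving bits. -/
lemma survivorLaw_tail_le (p : unitInterval) (m : ℕ) {t : ℝ} (ht : |t| ≤ 1) (r : ℝ) :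
    (survivorLaw p m).toOuterMeasure {a : ℕ | r ≤ t * (a - m * (1 - p))}
      ≤ ENNReal.ofReal (Real.exp (m * t ^ 2 - r)) := by
  set w : ℝ := Real.exp (-(t * (m * (1 - p))) - r) with hw
  calc (survivorLaw p m).toOuterMeasure {a : ℕ | r ≤ t * (a - m * (1 - p))}
      ≤ ∑' a, ENNReal.ofReal w * (survivorLaw p m a * ENNReal.ofReal (Real.exp (t * a))) := by
        rw [PMF.toOuterMeasure_apply]
        refine ENNReal.tsum_le_tsum fun a => ?_
        by_cases ha : r ≤ t * ((a : ℝ) - m * (1 - p))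
        swap
        · rw [Set.indicator_of_notMem (by exact ha)]
          exact zero_le
        rw [Set.indicator_of_mem (by exact ha)]
        rw [mul_left_comm, ← ENNReal.ofReal_mul (Real.exp_pos _).le, ← Real.exp_add]
        refine le_mul_of_one_le_right' ?_
        rw [ENNReal.one_le_ofReal]
        refine Real.one_le_exp ?_
        linarith
    _ = ENNReal.ofReal (w * (p + (1 - p) * Real.exp t) ^ m) := by
        rw [ENNReal.tsum_mul_left, tsum_survivorLaw_mul_exp, ← ENNReal.ofReal_mul (Real.exp_pos _).le]
    _ ≤ _ := by
        refine ENNReal.ofReal_le_ofReal ?_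
        have hp := p.2.1
        have hq : (0 : ℝ) ≤ 1 - p := sub_nonneg.2 p.2.2
        have h := pow_le_pow_left₀ (by positivity) (mgf_bernoulli_le p.2.1 p.2.2 ht) m
        rw [mul_pow, ← Real.exp_nat_mul, ← Real.exp_nat_mul] at h
        calc w * (p + (1 - p) * Real.exp t) ^ m
            = ((p + (1 - p) * Real.exp t) ^ m * Real.exp (m * -(t * (1 - p)))) * Real.exp (-r) := by
              rw [hw, mul_assoc, ← Real.exp_add, mul_comm]
              ring_nf
          _ ≤ Real.exp (m * t ^ 2) * Real.exp (-r) := by gcongr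
          _ = _ := by rw [← Real.exp_add, sub_eq_add_neg]

lemma survivorLaw_deviation_le (p : unitInterval) (m : ℕ) {t : ℝ} (h0 : 0 < t) (h1 : t ≤ 1)
    (r : ℝ) :
    (survivorLaw p m).toOuterMeasure {a : ℕ | r < |(a : ℝ) - m * (1 - p)|}
      ≤ 2 * ENNReal.ofReal (Real.exp (m * t ^ 2 - t * r)) := by
  have ht : |t| ≤ 1 := by rwa [abs_of_pos h0]
  have e1 := survivorLaw_tail_le p m ht (t * r)
  have e2 := survivorLaw_tail_le p m (t := -t) (by rwa [abs_neg]) (t * r)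
  rw [neg_sq] at e2
  rw [two_mul]
  refine le_trans ?_ (add_le_add e1 e2)
  refine le_trans (MeasureTheory.measure_mono ?_) (MeasureTheory.measure_union_le _ _)
  intro a ha
  rw [Set.mem_ofPred_eq, lt_abs] at ha
  rcases ha with ha | ha
  · exact Or.inl (mul_le_mul_of_nonneg_left ha.le h0.le)
  · refine Or.inr ?_
    rw [Set.mem_ofPred_eq, neg_mul, ← mul_neg]
    exact mul_le_mul_of_nonneg_left ha.le h0.le

/-! ### Marginals and union bounds for the gap laws -/

lemma productLaw_marginal {α : Type*} {k : ℕ} (μ : Fin k → PMF α) (i : Fin k) (B : Set α) :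
    (productLaw μ).toOuterMeasure {a | a i ∈ B} = (μ i).toOuterMeasure B := by
  classical
  -- Only the `i`-th factor is cut down to `B`; every other factor sums to one.
  have h := tsum_pi_prod fun j a => if j = i then B.indicator (μ i) a else μ j a
  rw [PMF.toOuterMeasure_apply, PMF.toOuterMeasure_apply]
  rw [Finset.prod_eq_single i (fun j _ hj => by simp [hj]) (by simp)] at h
  simp only [if_true] at h
  rw [← h]
  refine tsum_congr fun s => ?_
  by_cases hs : s i ∈ B
  · rw [Set.indicator_of_mem (by exact hs), productLaw_apply]
    refine Finset.prod_congr rfl fun j _ => ?_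
    split_ifs with hj
    · subst hj
      rw [Set.indicator_of_mem hs]
    · rfl
  · rw [Set.indicator_of_notMem (by exact hs)]
    exact (Finset.prod_eq_zero (Finset.mem_univ i) (by simp [hs])).symm

lemma productLaw_exists_le {α : Type*} {k : ℕ} (μ : Fin k → PMF α) (B : Set α) (τ : ℝ≥0∞)
    (h : ∀ i, (μ i).toOuterMeasure B ≤ τ) :
    (productLaw μ).toOuterMeasure {a | ∃ i, a i ∈ B} ≤ k * τ := by
  have e : {a : Fin k → α | ∃ i, a i ∈ B} = ⋃ i, {a | a i ∈ B} := by
    ext a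
    simp
  rw [e]
  refine (MeasureTheory.measure_iUnion_fintype_le _ _).trans ?_
  calc ∑ i, (productLaw μ).toOuterMeasure {a | a i ∈ B} ≤ ∑ _i : Fin k, τ :=
        Finset.sum_le_sum fun i _ => (productLaw_marginal μ i B).trans_le (h i)
    _ = k * τ := by simp

lemma gapMixture_exists_le (p : unitInterval) {k : ℕ} [NeZero k] (g : Fin k → ℕ) (B : Set ℕ)
    (τ : ℝ≥0∞) (h : ∀ i, (survivorLaw p (g i)).toOuterMeasure B ≤ τ) :
    (gapMixture p g).toOuterMeasure {a | ∃ i, a i ∈ B} ≤ k * τ := by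
  rw [gapMixture, PMF.toOuterMeasure_bind_apply]
  calc _ ≤ ∑' c, PMF.uniformOfFintype (Fin k) c * (k * τ) :=
        ENNReal.tsum_le_tsum fun c =>
          mul_le_mul_right (productLaw_exists_le _ _ _ fun i => h (i + c)) _
    _ = k * τ := by rw [ENNReal.tsum_mul_right, PMF.tsum_coe, one_mul]

lemma gapMixture_toReal (p : unitInterval) {k : ℕ} [NeZero k] (g : Fin k → ℕ) (a : Fin k → ℕ) :
    (gapMixture p g a).toReal = (k : ℝ)⁻¹ * ∑ c, ∏ i, survivorProb p (g (i + c)) (a i) := by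
  have hnn (c i) : 0 ≤ survivorProb p (g (i + c)) (a i) := survivorProb_nonneg p.2.1 p.2.2 _ _
  rw [gapMixture, PMF.bind_apply, tsum_fintype]
  simp only [PMF.uniformOfFintype_apply, productLaw_apply, survivorLaw_apply, Fintype.card_fin]
  rw [← Finset.mul_sum, ENNReal.toReal_mul, ENNReal.toReal_inv, ENNReal.toReal_natCast]
  congr 1
  rw [ENNReal.toReal_sum fun c _ => ENNReal.prod_ne_top fun i _ => ENNReal.ofReal_ne_top]
  refine Finset.sum_congr rfl fun c _ => ?_
  rw [ENNReal.toReal_prod]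
  exact Finset.prod_congr rfl fun i _ => ENNReal.toReal_ofReal (hnn c i)

/-! ### Expansion of the likelihood ratio -/

/-- The two quantities are the second and third forward differences of the partial products `1`, `1
+ u₀`, `(1 + u₀)(1 + u₁)`, `(1 + u₀)(1 + u₁)(1 + u₂)`. They are grouped so that each summand has the
required order in `ε` by itself. -/
lemma newton_coeff_bounds {C ε u₀ u₁ u₂ : ℝ} (hC : 1 ≤ C) (hε0 : 0 ≤ ε)
    (h0 : |u₀| ≤ C * ε) (h1 : |u₁| ≤ C * ε) (h2 : |u₂| ≤ C * ε)
    (d1 : |u₁ - u₀| ≤ C * ε ^ 2) (d2 : |u₂ - u₁| ≤ C * ε ^ 2)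
    (s : |u₂ - 2 * u₁ + u₀| ≤ C * ε ^ 3) :
    |u₀ * u₁ + (u₁ - u₀)| ≤ 2 * C ^ 3 * ε ^ 2 ∧
    |u₀ * u₁ * u₂ + u₀ * (u₂ - u₁) + u₁ * ((u₂ - u₁) + (u₁ - u₀)) + (u₂ - 2 * u₁ + u₀)|
      ≤ 5 * C ^ 3 * ε ^ 3 := by
  have hC2 : C ^ 2 ≤ C ^ 3 := pow_le_pow_right₀ hC (by norm_num)
  have hC1 : C ≤ C ^ 3 := le_self_pow₀ hC (by norm_num)
  have m01 : |u₀ * u₁| ≤ (C * ε) * (C * ε) := by rw [abs_mul]; gcongr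
  have m012 : |u₀ * u₁ * u₂| ≤ (C * ε) * (C * ε) * (C * ε) := by rw [abs_mul]; gcongr
  have ma : |u₀ * (u₂ - u₁)| ≤ (C * ε) * (C * ε ^ 2) := by rw [abs_mul]; gcongr
  have mb : |u₁ * ((u₂ - u₁) + (u₁ - u₀))| ≤ (C * ε) * (C * ε ^ 2 + C * ε ^ 2) := by
    rw [abs_mul]
    gcongr
    exact (abs_add_le _ _).trans (add_le_add d2 d1)
  have p2 := mul_le_mul_of_nonneg_right hC2 (pow_nonneg hε0 2)
  have p1 := mul_le_mul_of_nonneg_right hC1 (pow_nonneg hε0 2)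
  have q2 := mul_le_mul_of_nonneg_right hC2 (pow_nonneg hε0 3)
  have q1 := mul_le_mul_of_nonneg_right hC1 (pow_nonneg hε0 3)
  constructor
  · refine (abs_add_le _ _).trans ?_
    nlinarith
  · refine ((abs_add_le _ _).trans (add_le_add_left ((abs_add_le _ _).trans
      (add_le_add_left (abs_add_le _ _) _)) _)).trans ?_
    nlinarith

/-- Successive ratios close to one, with small differences, are interpolated by a polynomial
whose coefficients decay geometrically. -/
lemma exists_interpolation_coeffs {C ε r1 r2 r3 : ℝ} (hC : 1 ≤ C) (hε0 : 0 ≤ ε) (hε1 : ε ≤ 1)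
    (b1 : |r1 - 1| ≤ C * ε) (b2 : |r2 - 1| ≤ C * ε) (b3 : |r3 - 1| ≤ C * ε)
    (c1 : |r1 - r2| ≤ C * ε ^ 2) (c2 : |r2 - r3| ≤ C * ε ^ 2)
    (second : |r1 - 2 * r2 + r3| ≤ C * ε ^ 3) :
    ∃ Γ : Fin 4 → ℝ, (∀ s, |Γ s| ≤ 5 * C ^ 3 * ε ^ (s : ℕ)) ∧
      ∑ s : Fin 4, (3 : ℝ) ^ (s : ℕ) * Γ s = r3 * r2 * r1 ∧
      ∑ s : Fin 4, (2 : ℝ) ^ (s : ℕ) * Γ s = r3 * r2 ∧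
      ∑ s : Fin 4, (1 : ℝ) ^ (s : ℕ) * Γ s = r3 ∧
      ∑ s : Fin 4, (0 : ℝ) ^ (s : ℕ) * Γ s = 1 := by
  obtain ⟨k2, k3⟩ := newton_coeff_bounds (u₀ := r3 - 1) (u₁ := r2 - 1) (u₂ := r1 - 1) hC hε0
    b3 b2 b1 (by simpa using c2) (by simpa using c1) (by
      refine le_trans (le_of_eq ?_) second
      congr 1
      ring)
  have hC1 : C ≤ C ^ 3 := le_self_pow₀ hC (by norm_num)
  have hC3 : 1 ≤ C ^ 3 := one_le_pow₀ hC
  have k1 : |r3 - 1| ≤ C ^ 3 * ε := b3.trans (by gcongr)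
  have ε21 : ε ^ 2 ≤ ε := by nlinarith
  have ε32 : ε ^ 3 ≤ ε ^ 2 := pow_le_pow_of_le_one hε0 hε1 (by norm_num)
  have P21 := mul_le_mul_of_nonneg_left ε21 (zero_le_one.trans hC3)
  have P32 := mul_le_mul_of_nonneg_left ε32 (zero_le_one.trans hC3)
  obtain ⟨Δ₁, hΔ₁⟩ : ∃ d, d = r3 - 1 := ⟨_, rfl⟩
  obtain ⟨Δ₂, hΔ₂⟩ : ∃ d, d = (r3 - 1) * (r2 - 1) + (r2 - 1 - (r3 - 1)) := ⟨_, rfl⟩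
  obtain ⟨Δ₃, hΔ₃⟩ : ∃ d, d = (r3 - 1) * (r2 - 1) * (r1 - 1) + (r3 - 1) * (r1 - 1 - (r2 - 1)) +
    (r2 - 1) * ((r1 - 1 - (r2 - 1)) + (r2 - 1 - (r3 - 1))) +
    (r1 - 1 - 2 * (r2 - 1) + (r3 - 1)) := ⟨_, rfl⟩
  rw [← hΔ₁] at k1
  rw [← hΔ₂] at k2
  rw [← hΔ₃] at k3
  have a1 := abs_le.1 k1
  have a2 := abs_le.1 k2
  have a3 := abs_le.1 k3
  -- The monomial coefficients of the Newton interpolant `1 + zΔ₁ + z(z-1)Δ₂/2 + z(z-1)(z-2)Δ₃/6` at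
  -- the nodes `0, 1, 2, 3`.
  obtain ⟨Γ, g0, g1, g2, g3⟩ : ∃ Γ : Fin 4 → ℝ, Γ 0 = 1 ∧ Γ 1 = Δ₁ - Δ₂ / 2 + Δ₃ / 3 ∧
      Γ 2 = Δ₂ / 2 - Δ₃ / 2 ∧ Γ 3 = Δ₃ / 6 :=
    ⟨![1, Δ₁ - Δ₂ / 2 + Δ₃ / 3, Δ₂ / 2 - Δ₃ / 2, Δ₃ / 6], rfl, rfl, rfl, rfl⟩
  have hsum (z : ℝ) : ∑ s : Fin 4, z ^ (s : ℕ) * Γ s =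
      1 + z * (Δ₁ - Δ₂ / 2 + Δ₃ / 3) + z ^ 2 * (Δ₂ / 2 - Δ₃ / 2) + z ^ 3 * (Δ₃ / 6) := by
    rw [Fin.sum_univ_four, g0, g1, g2, g3]
    simp
  refine ⟨Γ, fun s => ?_, ?_, ?_, ?_, ?_⟩
  · match s with
    | 0 =>
      change |Γ 0| ≤ 5 * C ^ 3 * ε ^ 0
      rw [g0, abs_one]
      linarith
    | 1 =>
      change |Γ 1| ≤ 5 * C ^ 3 * ε ^ 1
      rw [g1, abs_le]
      constructor <;> linarith
    | 2 =>
      change |Γ 2| ≤ 5 * C ^ 3 * ε ^ 2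
      rw [g2, abs_le]
      constructor <;> linarith
    | 3 =>
      change |Γ 3| ≤ 5 * C ^ 3 * ε ^ 3
      rw [g3, abs_le]
      constructor <;> linarith
  all_goals
    rw [hsum, hΔ₁, hΔ₂, hΔ₃]
    ring

/-- Near the mean, the binomial probabilities with `n`, `n + 1`, `n + 2`, `n + 3` trials are
obtained from each other by a polynomial whose coefficients decay geometrically. -/
lemma survivorProb_expansion {p ε : ℝ} {n a : ℕ} (hp0 : 0 < p) (hp1 : p < 1) (hε0 : 0 < ε)
    (hsmall : 26 / p * ε ≤ 1 / 2) (hn : 1 ≤ n * ε ^ 2)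
    (ha : |(a : ℝ) - n * (1 - p)| ≤ 12 * n * ε) :
    ∃ Γ : Fin 4 → ℝ, (∀ s, |Γ s| ≤ 5 * (26 / p) ^ 3 * ε ^ (s : ℕ)) ∧
      ∀ x : ℕ, x ≤ 3 →
        survivorProb p (n + x) a =
          survivorProb p (n + 3) a * ∑ s : Fin 4, (3 - x : ℝ) ^ (s : ℕ) * Γ s ∧
        1 / 8 ≤ ∑ s : Fin 4, (3 - x : ℝ) ^ (s : ℕ) * Γ s := by
  -- The constant is set by the second difference of the ratios: `a ≤ 13n`, doubled. The bounds
  -- `15/p` and `13/p` needed for the deviation and the first difference are smaller.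
  set C := 26 / p with hCdef
  have hC : 1 ≤ C := by
    rw [hCdef, one_le_div hp0]
    linarith
  have hε1 : ε ≤ 1 := by nlinarith
  have hn0 : (0 : ℝ) < n := by
    by_contra h
    nlinarith [sq_nonneg ε]
  have hnε : 1 ≤ n * ε := by nlinarith
  have hn1 : (1 : ℝ) ≤ n := by nlinarith
  have hinv : 1 / (n : ℝ) ≤ ε ^ 2 := by
    rw [div_le_iff₀ hn0]
    linarith
  have hinv2 : 1 / (n : ℝ) ^ 2 ≤ ε ^ 3 := by
    calc 1 / (n : ℝ) ^ 2 = (1 / n) ^ 2 := by rw [div_pow, one_pow]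
      _ ≤ (ε ^ 2) ^ 2 := by gcongr
      _ = ε ^ 3 * ε := by ring
      _ ≤ ε ^ 3 * 1 := by gcongr
      _ = _ := mul_one _
  have ha' := abs_le.1 ha
  have ha13 : (a : ℝ) ≤ 13 * n := by nlinarith [mul_le_mul_of_nonneg_left hε1 hn0.le]
  have ha0 : (0 : ℝ) ≤ a := a.cast_nonneg
  -- The ratio of the probabilities of `a` for `n + l - 1` and for `n + l` trials.
  set ρ : ℝ → ℝ := fun l => (n + l - a) / ((n + l) * p) with hρ
  have dev (l : ℝ) (l0 : 0 ≤ l) (l3 : l ≤ 3) : |ρ l - 1| ≤ C * ε := by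
    have hpos : 0 < (n + l) * p := by positivity
    have e : ρ l - 1 = ((n + l) * (1 - p) - a) / ((n + l) * p) := by
      rw [hρ]
      field_simp
      ring
    have num : |(n + l) * (1 - p) - a| ≤ 15 * n * ε := by
      rw [abs_le]
      have : l * (1 - p) ≤ 3 := by nlinarith
      have : 0 ≤ l * (1 - p) := mul_nonneg l0 (by linarith)
      constructor <;> nlinarith
    rw [e, abs_div, abs_of_pos hpos, div_le_iff₀ hpos]
    have : C * ε * ((n + l) * p) = 26 * ε * (n + l) := by
      rw [hCdef]
      field_simp
    rw [this]
    nlinarith [mul_nonneg hε0.le l0]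
  have diff (l : ℝ) (l0 : 0 ≤ l) : |ρ l - ρ (l + 1)| ≤ C * ε ^ 2 := by
    have h1 : 0 < n + l := by positivity
    have e : ρ l - ρ (l + 1) = -(a / p * (1 / ((n + l) * (n + l + 1)))) := by
      rw [hρ]
      have : (0 : ℝ) < n + (l + 1) := by positivity
      field_simp
      ring
    rw [e, abs_neg, abs_of_nonneg (by positivity)]
    calc (a : ℝ) / p * (1 / ((n + l) * (n + l + 1))) ≤ 13 * n / p * (1 / (n * n)) := by
          gcongr <;> linarith
      _ = 13 / p * (1 / n) := by field_simp
      _ ≤ 26 / p * ε ^ 2 := by gcongr; norm_num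
  have second : |ρ 1 - 2 * ρ 2 + ρ 3| ≤ C * ε ^ 3 := by
    have e : ρ 1 - 2 * ρ 2 + ρ 3 = -(a / p * (2 / ((n + 1) * (n + 2) * (n + 3)))) := by
      rw [hρ]
      field_simp
      ring
    rw [e, abs_neg, abs_of_nonneg (by positivity)]
    calc (a : ℝ) / p * (2 / ((n + 1) * (n + 2) * (n + 3))) ≤ 13 * n / p * (2 / (n * n * n)) := by
          gcongr <;> linarith
      _ = 26 / p * (1 / n ^ 2) := by field_simp; norm_num
      _ ≤ 26 / p * ε ^ 3 := by gcongr
  have step (l : ℕ) : survivorProb p (n + l) a = survivorProb p (n + l + 1) a * ρ (l + 1) := by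
    have h := survivorProb_mul_succ p (n + l) a
    have hpos : 0 < ((n : ℝ) + l + 1) * p := by positivity
    rw [hρ]
    push_cast at h
    rw [mul_div_assoc', ← add_assoc, eq_div_iff hpos.ne', h]
  have s0 := step 0
  have s1 := step 1
  have s2 := step 2
  norm_num at s0 s1 s2
  have b1 := dev 1 (by norm_num) (by norm_num)
  have b2 := dev 2 (by norm_num) (by norm_num)
  have b3 := dev 3 (by norm_num) (by norm_num)
  have c1 := diff 1 (by norm_num)
  have c2 := diff 2 (by norm_num)
  norm_num at c1 c2
  -- Each ratio is at least `1/2`, so a product of at most three of them is at least `1/8`.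
  have g1 : 1 / 2 ≤ ρ 1 := by linarith [(abs_le.1 b1).1]
  have g2 : 1 / 2 ≤ ρ 2 := by linarith [(abs_le.1 b2).1]
  have g3 : 1 / 2 ≤ ρ 3 := by linarith [(abs_le.1 b3).1]
  generalize ρ 1 = r1 at *
  generalize ρ 2 = r2 at *
  generalize ρ 3 = r3 at *
  obtain ⟨Γ, hΓ, e0, e1, e2, e3⟩ :=
    exists_interpolation_coeffs hC hε0.le hε1 b1 b2 b3 c1 c2 second
  have hr : (1 / 2 : ℝ) * (1 / 2) ≤ r3 * r2 := by gcongr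
  have hr' : (1 / 2 : ℝ) * (1 / 2) * (1 / 2) ≤ r3 * r2 * r1 := by gcongr
  refine ⟨Γ, hΓ, fun x hx => ?_⟩
  interval_cases x
  · rw [show (3 - ((0 : ℕ) : ℝ)) = 3 by norm_num, e0, add_zero, s0, s1, s2]
    exact ⟨by ring, by linarith⟩
  · rw [show (3 - ((1 : ℕ) : ℝ)) = 2 by norm_num, e1, s1, s2]
    exact ⟨by ring, by linarith⟩
  · rw [show (3 - ((2 : ℕ) : ℝ)) = 1 by norm_num, e2]
    exact ⟨s2, by linarith⟩
  · rw [show (3 - ((3 : ℕ) : ℝ)) = 0 by norm_num, e3]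
    norm_num

/-! ### Cancellation from equal cyclic statistics -/

/-- A monomial with exponents `r` is a cyclic statistic whose index tuple lists each `i` exactly `r
i` times. -/
lemma sum_prod_pow_eq_cyclicStat {k : ℕ} [NeZero k] (x : Fin k → ℤ) (r : Fin k → ℕ) :
    ∑ j, ∏ i, x (i + j) ^ r i =
      cyclicStat (fun t : Fin (∑ i, r i) => (finSigmaFinEquiv.symm t).1) x := by
  unfold cyclicStat
  refine Finset.sum_congr rfl fun j _ => ?_
  rw [← Equiv.prod_comp finSigmaFinEquiv, Fintype.prod_sigma]
  simp

lemma SameCyclicStats.sum_prod_pow_eq {k M : ℕ} [NeZero k] {x y : Fin k → ℤ}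
    (h : SameCyclicStats M x y) (r : Fin k → ℕ) (hr : ∑ i, r i ≤ M) :
    ∑ j, ∏ i, x (i + j) ^ r i = ∑ j, ∏ i, y (i + j) ^ r i := by
  rw [sum_prod_pow_eq_cyclicStat, sum_prod_pow_eq_cyclicStat]
  exact h _ hr _

lemma sum_prod_sum_eq {k D : ℕ} [NeZero k] (x : Fin k → ℤ) (Γ : Fin k → Fin D → ℝ) :
    ∑ j, ∏ i, ∑ s : Fin D, (x (i + j) : ℝ) ^ (s : ℕ) * Γ i s =
      ∑ r : Fin k → Fin D, (∏ i, Γ i (r i)) * ((∑ j, ∏ i, x (i + j) ^ (r i : ℕ) : ℤ) : ℝ) := by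
  simp only [Finset.prod_univ_sum, Fintype.piFinset_univ]
  rw [Finset.sum_comm]
  refine Finset.sum_congr rfl fun r _ => ?_
  push_cast
  rw [Finset.mul_sum]
  refine Finset.sum_congr rfl fun j _ => ?_
  rw [Finset.prod_mul_distrib, mul_comm]

lemma abs_sum_prod_pow_le {k D : ℕ} [NeZero k] {x : Fin k → ℤ} {b : ℝ} (hb : 1 ≤ b)
    (hx : ∀ i, |(x i : ℝ)| ≤ b) (r : Fin k → Fin D) :
    |((∑ j, ∏ i, x (i + j) ^ (r i : ℕ) : ℤ) : ℝ)| ≤ k * (b ^ D) ^ k := by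
  push_cast
  refine (Finset.abs_sum_le_sum_abs _ _).trans ?_
  calc ∑ j, |∏ i, (x (i + j) : ℝ) ^ (r i : ℕ)| ≤ ∑ _j : Fin k, (b ^ D) ^ k := by
        refine Finset.sum_le_sum fun j _ => ?_
        rw [Finset.abs_prod]
        calc ∏ i, |(x (i + j) : ℝ) ^ (r i : ℕ)| ≤ ∏ _i : Fin k, b ^ D := by
              refine Finset.prod_le_prod (fun _ _ => abs_nonneg _) fun i _ => ?_
              rw [abs_pow]
              exact (pow_le_pow_left₀ (abs_nonneg _) (hx _) _).trans
                (pow_le_pow_right₀ hb (r i).2.le)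
          _ = _ := by simp
    _ = _ := by simp

/-- Sequences with equal cyclic statistics up to order `M` give cyclic sums of products of
polynomials that agree up to order `M` in the small parameter. -/
lemma SameCyclicStats.abs_sum_prod_sub_le {k D M : ℕ} [NeZero k] {x y : Fin k → ℤ}
    (h : SameCyclicStats M x y) {b : ℝ} (hb : 1 ≤ b) (hx : ∀ i, |(x i : ℝ)| ≤ b)
    (hy : ∀ i, |(y i : ℝ)| ≤ b) {K ε : ℝ} (hε0 : 0 ≤ ε) (hε1 : ε ≤ 1)
    (Γ : Fin k → Fin D → ℝ) (hΓ : ∀ i s, |Γ i s| ≤ K * ε ^ (s : ℕ)) :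
    |∑ j, ∏ i, ∑ s : Fin D, (x (i + j) : ℝ) ^ (s : ℕ) * Γ i s
      - ∑ j, ∏ i, ∑ s : Fin D, (y (i + j) : ℝ) ^ (s : ℕ) * Γ i s|
      ≤ (D : ℝ) ^ k * (|K| ^ k * (k * (b ^ D) ^ k + k * (b ^ D) ^ k)) * ε ^ (M + 1) := by
  rw [sum_prod_sum_eq, sum_prod_sum_eq, ← Finset.sum_sub_distrib]
  refine (Finset.abs_sum_le_sum_abs _ _).trans ?_
  calc _ ≤ ∑ _r : Fin k → Fin D,
        (|K| ^ k * (k * (b ^ D) ^ k + k * (b ^ D) ^ k)) * ε ^ (M + 1) := by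
        refine Finset.sum_le_sum fun r _ => ?_
        rw [← mul_sub]
        -- Monomials of degree at most `M` cancel; all others carry at least `M + 1` factors of `ε`.
        by_cases hr : ∑ i, (r i : ℕ) ≤ M
        · rw [h.sum_prod_pow_eq (fun i => (r i : ℕ)) hr, sub_self, mul_zero, abs_zero]
          positivity
        · have hprod : |∏ i, Γ i (r i)| ≤ |K| ^ k * ε ^ (M + 1) := by
            rw [Finset.abs_prod]
            calc ∏ i, |Γ i (r i)| ≤ ∏ i, |K| * ε ^ (r i : ℕ) := by
                  refine Finset.prod_le_prod (fun _ _ => abs_nonneg _) fun i _ =>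
                    (hΓ i (r i)).trans ?_
                  gcongr
                  exact le_abs_self K
              _ = |K| ^ k * ε ^ ∑ i, (r i : ℕ) := by
                  rw [Finset.prod_mul_distrib, Finset.prod_pow_eq_pow_sum]
                  simp
              _ ≤ _ := by
                  gcongr _ * ?_
                  exact pow_le_pow_of_le_one hε0 hε1 (by omega)
          rw [abs_mul, mul_right_comm]
          gcongr
          exact (abs_sub _ _).trans
            (add_le_add (abs_sum_prod_pow_le hb hx r) (abs_sum_prod_pow_le hb hy r))
    _ = _ := by
        simp [mul_assoc]

/-! ### The affinity of the gap laws -/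

lemma survivorLaw_far_le (p : unitInterval) {n z : ℕ} {ε : ℝ} (hz : z ≤ 3) (hε0 : 0 < ε)
    (hε1 : ε ≤ 1) (hn : 1 ≤ n * ε ^ 2) (hexp : Real.exp (-(n * ε ^ 2)) ≤ ε ^ 2) :
    (survivorLaw p (n + z)).toOuterMeasure {a : ℕ | 12 * n * ε < |(a : ℝ) - n * (1 - p)|}
      ≤ 2 * ENNReal.ofReal (ε ^ 10) := by
  have hz' : (z : ℝ) ≤ 3 := by exact_mod_cast hz
  have hp0 := p.2.1
  have hp1 := p.2.2
  have hnε : 1 ≤ n * ε := by nlinarith [n.cast_nonneg (α := ℝ)]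
  have hn1 : (1 : ℝ) ≤ n := by nlinarith [n.cast_nonneg (α := ℝ)]
  -- Recentring from `(n + z)(1 - p)` to `n(1 - p)` costs at most `3 ≤ 3nε`, hence `9` in place of
  -- `12`. With `t = ε` the exponent is at most `(1 + 3 - 9)nε² = -5nε²`, and the fifth power turns
  -- `ε^2` into `ε^10`.
  refine le_trans (MeasureTheory.measure_mono ?_) ((survivorLaw_deviation_le p (n + z) hε0 hε1
    (9 * n * ε)).trans (mul_le_mul_right (ENNReal.ofReal_le_ofReal ?_) _))
  · intro a ha
    change 12 * n * ε < |(a : ℝ) - n * (1 - p)| at ha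
    change 9 * n * ε < |(a : ℝ) - (n + z : ℕ) * (1 - p)|
    have h := abs_sub_le (a : ℝ) ((n + z : ℕ) * (1 - p)) (n * (1 - p))
    have e : (((n + z : ℕ) : ℝ) * (1 - p) - n * (1 - p)) = z * (1 - p) := by
      push_cast
      ring
    have hq : (z : ℝ) * (1 - p) ≤ 3 := by nlinarith [z.cast_nonneg (α := ℝ)]
    have hq0 : 0 ≤ (z : ℝ) * (1 - p) := mul_nonneg z.cast_nonneg (sub_nonneg.2 hp1)
    rw [e, abs_of_nonneg hq0] at h
    linarith
  · calc Real.exp ((n + z : ℕ) * ε ^ 2 - ε * (9 * n * ε))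
        ≤ Real.exp ((5 : ℕ) * -(n * ε ^ 2)) := by
          rw [Real.exp_le_exp]
          push_cast
          nlinarith [mul_le_mul_of_nonneg_right (hz'.trans (show (3 : ℝ) ≤ 3 * n by linarith))
            (sq_nonneg ε)]
      _ = Real.exp (-(n * ε ^ 2)) ^ 5 := Real.exp_nat_mul _ _
      _ ≤ (ε ^ 2) ^ 5 := by gcongr
      _ = ε ^ 10 := by ring

/-- The factor with `n + 3` trials in every gap does not involve `z`, so it is common to both
sequences and only the cyclic sums remain to be compared. -/
lemma gapMixture_toReal_eq (p : unitInterval) {k n : ℕ} [NeZero k] (z : Fin k → ℕ)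
    (hz : ∀ i, z i ≤ 3) (a : Fin k → ℕ) (Γ : Fin k → Fin 4 → ℝ)
    (hval : ∀ i, ∀ x : ℕ, x ≤ 3 → survivorProb p (n + x) (a i) =
      survivorProb p (n + 3) (a i) * ∑ s : Fin 4, (3 - x : ℝ) ^ (s : ℕ) * Γ i s) :
    (gapMixture p (fun i => n + z i) a).toReal =
      (k : ℝ)⁻¹ * ((∏ i, survivorProb p (n + 3) (a i)) *
        ∑ c : Fin k, ∏ i : Fin k, ∑ s : Fin 4, ((3 - (z (i + c) : ℤ) : ℤ) : ℝ) ^ (s : ℕ) * Γ i s) := by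
  rw [gapMixture_toReal]
  congr 1
  rw [Finset.mul_sum]
  refine Finset.sum_congr rfl fun c _ => ?_
  rw [← Finset.prod_mul_distrib]
  refine Finset.prod_congr rfl fun i _ => ?_
  rw [hval i (z (i + c)) (hz _)]
  push_cast
  rfl

lemma le_sum_prod_sum {k : ℕ} [NeZero k] (z : Fin k → ℕ) (hz : ∀ i, z i ≤ 3)
    (Γ : Fin k → Fin 4 → ℝ) {b : ℝ} (hb : 0 ≤ b)
    (hval : ∀ i, ∀ x : ℕ, x ≤ 3 → b ≤ ∑ s : Fin 4, (3 - x : ℝ) ^ (s : ℕ) * Γ i s) :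
    b ^ k ≤ ∑ c : Fin k, ∏ i : Fin k, ∑ s : Fin 4, ((3 - (z (i + c) : ℤ) : ℤ) : ℝ) ^ (s : ℕ) * Γ i s := by
  have hk1 : (1 : ℝ) ≤ k := by exact_mod_cast Nat.one_le_iff_ne_zero.2 (NeZero.ne k)
  have hterm (c : Fin k) : b ^ k ≤
      ∏ i, ∑ s : Fin 4, ((3 - (z (i + c) : ℤ) : ℤ) : ℝ) ^ (s : ℕ) * Γ i s := by
    calc b ^ k = ∏ _i : Fin k, b := by simp
      _ ≤ _ := by
        refine Finset.prod_le_prod (fun _ _ => hb) fun i _ => ?_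
        have := hval i (z (i + c)) (hz _)
        push_cast
        exact this
  calc b ^ k ≤ k * b ^ k := le_mul_of_one_le_left (by positivity) hk1
    _ = ∑ _c : Fin k, b ^ k := by simp
    _ ≤ _ := Finset.sum_le_sum fun c _ => hterm c

lemma abs_three_sub_le {z : ℕ} (hz : z ≤ 3) : |((3 - (z : ℤ) : ℤ) : ℝ)| ≤ 3 := by
  have h3 : (z : ℝ) ≤ 3 := by exact_mod_cast hz
  have h0 : (0 : ℝ) ≤ z := Nat.cast_nonneg _
  push_cast
  rw [abs_le]
  constructor <;> linarith

/-- At gap vectors near the mean, the two gap laws have nearly equal densities. -/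
lemma exists_gapMixture_close (p : unitInterval) (hp0 : 0 < (p : ℝ)) (hp1 : (p : ℝ) < 1) {k : ℕ}
    [NeZero k] (x y : Fin k → ℕ) (hx : ∀ i, x i ≤ 3) (hy : ∀ i, y i ≤ 3)
    (hxy : SameCyclicStats 4 (fun i => 3 - (x i : ℤ)) fun i => 3 - (y i : ℤ)) :
    ∃ D : ℝ, 0 ≤ D ∧ ∀ (n : ℕ) (ε : ℝ), 0 < ε → ε ≤ 1 → 26 / (p : ℝ) * ε ≤ 1 / 2 →
      1 ≤ n * ε ^ 2 → ∀ a : Fin k → ℕ, (∀ i, |(a i : ℝ) - n * (1 - p)| ≤ 12 * n * ε) →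
      |(gapMixture p (fun i => n + x i) a).toReal - (gapMixture p (fun i => n + y i) a).toReal| ≤
        D * ε ^ 5 * ((gapMixture p (fun i => n + x i) a).toReal +
          (gapMixture p (fun i => n + y i) a).toReal) := by
  obtain ⟨D, hD⟩ : ∃ D : ℝ, D = ((4 : ℕ) : ℝ) ^ k * (|5 * (26 / (p : ℝ)) ^ 3| ^ k *
    (k * ((3 : ℝ) ^ 4) ^ k + k * ((3 : ℝ) ^ 4) ^ k)) := ⟨_, rfl⟩
  have hD0 : 0 ≤ D := by
    rw [hD]
    positivity
  -- `D` bounds the absolute error of the cyclic sums. These are at least `(1/8)^k`, so the factor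
  -- `8^k` makes the error relative.
  refine ⟨D * 8 ^ k, by positivity, fun n ε hε0 hε1 hsmall hn a hnear => ?_⟩
  choose Γ hΓ hval using fun i => survivorProb_expansion hp0 hp1 hε0 hsmall hn (hnear i)
  have close := hxy.abs_sum_prod_sub_le (b := 3) (by norm_num) (fun i => abs_three_sub_le (hx i))
    (fun i => abs_three_sub_le (hy i)) hε0.le hε1 Γ hΓ
  have low (i : Fin k) (x : ℕ) (h : x ≤ 3) := (hval i x h).2
  have eq (i : Fin k) (x : ℕ) (h : x ≤ 3) := (hval i x h).1
  have lx := le_sum_prod_sum x hx Γ (by norm_num) low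
  have ly := le_sum_prod_sum y hy Γ (by norm_num) low
  rw [gapMixture_toReal_eq p x hx a Γ eq, gapMixture_toReal_eq p y hy a Γ eq]
  have hP0 : 0 ≤ ∏ i, survivorProb p (n + 3) (a i) :=
    Finset.prod_nonneg fun i _ => survivorProb_nonneg hp0.le hp1.le _ _
  generalize ∏ i, survivorProb p (n + 3) (a i) = P at *
  generalize ∑ c : Fin k, ∏ i : Fin k, ∑ s : Fin 4, ((3 - (x (i + c) : ℤ) : ℤ) : ℝ) ^ (s : ℕ) * Γ i s = F at *
  generalize ∑ c : Fin k, ∏ i : Fin k, ∑ s : Fin 4, ((3 - (y (i + c) : ℤ) : ℤ) : ℝ) ^ (s : ℕ) * Γ i s = G at *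
  have e8 : (8 : ℝ) ^ k * (1 / 8) ^ k = 1 := by
    rw [← mul_pow]
    norm_num
  have h8 : 0 ≤ (1 / 8 : ℝ) ^ k := by positivity
  have key : |F - G| ≤ D * 8 ^ k * ε ^ 5 * (F + G) := by
    calc |F - G| ≤ D * ε ^ 5 := by
          rw [hD]
          exact close
      _ = D * 8 ^ k * ε ^ 5 * (1 / 8) ^ k := by linear_combination (-(D * ε ^ 5)) * e8
      _ ≤ D * 8 ^ k * ε ^ 5 * (F + G) := by
        gcongr
        linarith
  rw [← mul_sub, ← mul_sub, ← mul_add, ← mul_add, abs_mul, abs_mul, abs_of_nonneg hP0,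
    abs_of_nonneg (inv_nonneg.2 k.cast_nonneg)]
  calc (k : ℝ)⁻¹ * (P * |F - G|) ≤ (k : ℝ)⁻¹ * (P * (D * 8 ^ k * ε ^ 5 * (F + G))) := by gcongr
    _ = _ := by ring

/-- The gap vectors all of whose entries are close to the mean `n * (1 - p)`. -/
def nearMean (p : ℝ) (k n : ℕ) (ε : ℝ) : Set (Fin k → ℕ) :=
  {a | ∀ i, |(a i : ℝ) - n * (1 - p)| ≤ 12 * n * ε}

lemma gapMixture_compl_nearMean_le (p : unitInterval) {k n : ℕ} [NeZero k] (z : Fin k → ℕ)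
    (hz : ∀ i, z i ≤ 3) {ε : ℝ} (hε0 : 0 < ε) (hε1 : ε ≤ 1) (hn : 1 ≤ n * ε ^ 2)
    (hexp : Real.exp (-(n * ε ^ 2)) ≤ ε ^ 2) :
    (gapMixture p fun i => n + z i).toOuterMeasure (nearMean p k n ε)ᶜ
        ≤ ENNReal.ofReal (2 * k * ε ^ 10) := by
  have hτ : (k : ℝ≥0∞) * (2 * ENNReal.ofReal (ε ^ 10)) = ENNReal.ofReal (2 * k * ε ^ 10) := by
    rw [ENNReal.ofReal_mul (by positivity), ENNReal.ofReal_mul (by norm_num),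
      ENNReal.ofReal_natCast, ENNReal.ofReal_ofNat, mul_left_comm, mul_assoc]
  rw [← hτ]
  refine le_trans (MeasureTheory.measure_mono fun a ha => ?_) (gapMixture_exists_le p _ _ _ fun i =>
    survivorLaw_far_le p (hz i) hε0 hε1 hn hexp)
  by_contra h
  exact ha fun i => not_lt.1 fun hi => h ⟨i, hi⟩

/-- If the cyclic statistics of two gap sequences agree up to order `4`, then the laws of the
thinned gaps have affinity at least `1 - O(ε ^ 10)` for `ε = √(log n / n)`. -/
theorem le_affinity_gapMixture (p : unitInterval) (hp0 : 0 < (p : ℝ)) (hp1 : (p : ℝ) < 1) {k : ℕ}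
    [NeZero k] (x y : Fin k → ℕ) (hx : ∀ i, x i ≤ 3) (hy : ∀ i, y i ≤ 3)
    (hxy : SameCyclicStats 4 (fun i => 3 - (x i : ℤ)) fun i => 3 - (y i : ℤ)) :
    ∃ H : ℝ, 0 < H ∧ ∀ (n : ℕ) (ε : ℝ), 0 < ε → 26 / (p : ℝ) * ε ≤ 1 / 2 → 1 ≤ n * ε ^ 2 →
      Real.exp (-(n * ε ^ 2)) ≤ ε ^ 2 →
      ENNReal.ofReal (1 - H * ε ^ 10) ≤
        affinity (gapMixture p fun i => n + x i) (gapMixture p fun i => n + y i) := by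
  have hk' : (0 : ℝ) < k := by exact_mod_cast Nat.pos_of_ne_zero (NeZero.ne k)
  obtain ⟨D, hD0, hD⟩ := exists_gapMixture_close p hp0 hp1 x y hx hy hxy
  refine ⟨D ^ 2 + 2 * k, by positivity, fun n ε hε0 hsmall hn hexp => ?_⟩
  have hε1 : ε ≤ 1 := by
    have : 1 ≤ 26 / (p : ℝ) := by
      rw [one_le_div hp0]
      linarith
    nlinarith
  have hτ0 : 0 ≤ 2 * k * ε ^ 10 := by positivity
  rw [show (D ^ 2 + 2 * k) * ε ^ 10 = (D * ε ^ 5) ^ 2 + 2 * k * ε ^ 10 by ring]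
  -- If `(D * ε ^ 5) ^ 2 > 1` the claimed lower bound is `ENNReal.ofReal` of a negative number, that
  -- is, zero.
  rcases lt_or_ge 1 ((D * ε ^ 5) ^ 2) with hbig | hη1
  · rw [ENNReal.ofReal_of_nonpos (by linarith)]
    exact zero_le
  exact le_affinity _ _ (nearMean p k n ε) hη1 hτ0
    (fun a ha => hD n ε hε0 hε1 hsmall hn a ha)
    (gapMixture_compl_nearMean_le p x hx hε0 hε1 hn hexp)
    (gapMixture_compl_nearMean_le p y hy hε0 hε1 hn hexp)

lemma le_mul_of_ofReal_pow_le {h : ℝ} {b : ℝ≥0∞} {T : ℕ} (hb : ENNReal.ofReal (1 - h) ≤ b)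
    (hT : b ^ T ≤ ENNReal.ofReal (17 / 18)) : 1 / 18 ≤ T * h := by
  have hT' : ENNReal.ofReal (1 - h) ^ T ≤ ENNReal.ofReal (17 / 18) :=
    (pow_le_pow_left₀ (zero_le) hb T).trans hT
  -- For `h ≤ 1` this is Bernoulli's inequality. For `h > 1` the base truncates to zero, and it is
  -- enough that `T = 0` would give `1 ≤ 17/18`.
  rcases le_or_gt h 1 with h1 | h1
  · rw [← ENNReal.ofReal_pow (by linarith), ENNReal.ofReal_le_ofReal_iff (by norm_num)] at hT'
    have := one_add_mul_le_pow (a := -h) (by linarith) T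
    rw [← sub_eq_add_neg] at this
    linarith
  · have : T ≠ 0 := by
      rintro rfl
      rw [pow_zero, ← ENNReal.ofReal_one, ENNReal.ofReal_le_ofReal_iff (by norm_num)] at hT'
      norm_num at hT'
    have : (1 : ℝ) ≤ T := by exact_mod_cast Nat.one_le_iff_ne_zero.2 this
    nlinarith

/-- Gap sequences with equal cyclic statistics up to order `4` need `Ω(n ^ 5 / log ^ 5 n)` traces
to be told apart by any event. -/
theorem exists_trace_lower_bound (p : unitInterval) (hp0 : 0 < (p : ℝ)) (hp1 : (p : ℝ) < 1)
    {k : ℕ} [NeZero k] (x y : Fin k → ℕ) (hx : ∀ i, x i ≤ 3) (hy : ∀ i, y i ≤ 3)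
    (hxy : SameCyclicStats 4 (fun i => 3 - (x i : ℤ)) fun i => 3 - (y i : ℤ)) :
    ∃ c : ℝ, 0 < c ∧ ∃ n₀ : ℕ, ∀ n : ℕ, n₀ ≤ n → ∀ (T : ℕ) (A : Algorithm T)
      (E : Set (List Bool)),
      2 / 3 ≤ (A.output p (gapString fun i => n + x i)).toOuterMeasure E →
      (A.output p (gapString fun i => n + y i)).toOuterMeasure E ≤ 1 / 3 →
      c * ((n : ℝ) ^ 5 / Real.log n ^ 5) ≤ T := by
  obtain ⟨H, hH, hmain⟩ := le_affinity_gapMixture p hp0 hp1 x y hx hy hxy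
  have hlim : Filter.Tendsto (fun n : ℕ => Real.log n / n) Filter.atTop (nhds 0) :=
    (Real.isLittleO_log_id_atTop.tendsto_div_nhds_zero).comp tendsto_natCast_atTop_atTop
  have hev := hlim.eventually_lt_const (show (0 : ℝ) < ((p : ℝ) / 52) ^ 2 by positivity)
  obtain ⟨n₁, hn₁⟩ := Filter.eventually_atTop.1 hev
  -- `n ≥ 3 > e` gives `log n ≥ 1`, whence `nε² ≥ 1` and `exp (-nε²) = 1/n ≤ ε²`. The threshold `n₁`
  -- gives `ε ≤ p/52`.
  refine ⟨1 / (18 * H), by positivity, max n₁ 3, fun n hn T A E hE hE' => ?_⟩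
  have hn3 : (3 : ℝ) ≤ n := by exact_mod_cast (le_max_right _ _).trans hn
  have hn0 : (0 : ℝ) < n := by linarith
  have hlog : 1 ≤ Real.log n := by
    rw [Real.le_log_iff_exp_le hn0]
    linarith [Real.exp_one_lt_three]
  have hq0 : 0 < Real.log n / n := by positivity
  set ε := √(Real.log n / n) with hε
  have hε0 : 0 < ε := Real.sqrt_pos.2 hq0
  have hε2 : ε ^ 2 = Real.log n / n := Real.sq_sqrt hq0.le
  have hnε : n * ε ^ 2 = Real.log n := by
    rw [hε2]
    field_simp
  have hsmall : ε ≤ (p : ℝ) / 52 :=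
    Real.sqrt_le_iff.2 ⟨by positivity, (hn₁ n ((le_max_left _ _).trans hn)).le⟩
  have haff := hmain n ε hε0 (by
      calc 26 / (p : ℝ) * ε ≤ 26 / (p : ℝ) * ((p : ℝ) / 52) := by gcongr
        _ = 1 / 2 := by field_simp; norm_num)
    (by rw [hnε]; exact hlog)
    (by
      rw [hnε, Real.exp_neg, Real.exp_log hn0, hε2, inv_eq_one_div]
      gcongr)
  have hT := le_mul_of_ofReal_pow_le haff (affinity_gapMixture_pow_le p _ _ A E hE hE')
  have e10 : ε ^ 10 = Real.log n ^ 5 / (n : ℝ) ^ 5 := by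
    rw [← div_pow, ← hε2]
    ring
  rw [e10] at hT
  have hl5 : 0 < Real.log n ^ 5 := by positivity
  have hn5 : (0 : ℝ) < (n : ℝ) ^ 5 := by positivity
  calc 1 / (18 * H) * ((n : ℝ) ^ 5 / Real.log n ^ 5)
      = (1 / 18) * ((n : ℝ) ^ 5 / Real.log n ^ 5 / H) := by field_simp
    _ ≤ (T * (H * (Real.log n ^ 5 / (n : ℝ) ^ 5))) * ((n : ℝ) ^ 5 / Real.log n ^ 5 / H) := by
        gcongr
    _ = T := by field_simp

/-! ### Gap strings up to rotation -/

lemma length_gapString : ∀ {k : ℕ} (g : Fin k → ℕ), (gapString g).length = k + ∑ i, g i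
  | 0, g => by simp [gapString_zero]
  | k + 1, g => by
      rw [gapString_succ, Fin.sum_univ_succ]
      simp only [List.length_append, List.length_replicate, length_gapString, List.length_singleton]
      simp only [Fin.tail]
      omega

/-- The number of zeros before the first one, and the list of the numbers of zeros that follow the
successive ones. -/
def readGaps : List Bool → ℕ × List ℕ
  | [] => (0, [])
  | false :: l => ((readGaps l).1 + 1, (readGaps l).2)
  | true :: l => (0, (readGaps l).1 :: (readGaps l).2)

lemma readGaps_append (l m : List Bool) (h : (readGaps m).1 = 0) :
    readGaps (l ++ m) = ((readGaps l).1, (readGaps l).2 ++ (readGaps m).2) := by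
  induction l with
  | nil =>
    rw [List.nil_append, readGaps, List.nil_append, ← h]
  | cons b l ih => cases b <;> simp [readGaps, ih]

lemma readGaps_append_fst {l m : List Bool} (h : (readGaps (l ++ m)).1 = 0) :
    (readGaps l).1 = 0 := by
  cases l with
  | nil => rfl
  | cons b l =>
    cases b
    · simp [readGaps] at h
    · rfl

lemma readGaps_replicate (g : ℕ) : readGaps (List.replicate g false) = (g, []) := by
  induction g with
  | zero => rfl
  | succ g ih => simp [List.replicate_succ, readGaps, ih]

lemma readGaps_gapString : ∀ {k : ℕ} (g : Fin k → ℕ), readGaps (gapString g) = (0, List.ofFn g)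
  | 0, g => by simp [gapString_zero, readGaps]
  | k + 1, g => by
      have ih := readGaps_gapString (Fin.tail g)
      rw [gapString_succ, List.singleton_append, readGaps, readGaps_append _ _ (by rw [ih]), ih,
        readGaps_replicate, List.ofFn_succ]
      rfl

/-- Both strings, when nonempty, start with a one, so each of the two pieces of the cut is empty or
starts with a one. The cut therefore falls between blocks, and the shift is the number of ones in
the first piece. -/
lemma exists_shift_of_isRotated {k : ℕ} [NeZero k] {g h : Fin k → ℕ}
    (hr : (gapString g).IsRotated (gapString h)) : ∃ c : Fin k, ∀ j, g (j + c) = h j := by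
  obtain ⟨m, hm, e⟩ := List.isRotated_iff_mod.1 hr
  rw [List.rotate_eq_drop_append_take hm] at e
  have hg := readGaps_gapString g
  have hh := readGaps_gapString h
  rw [← List.take_append_drop m (gapString g)] at hg
  rw [← e] at hh
  generalize List.take m (gapString g) = u at *
  generalize List.drop m (gapString g) = v at *
  have hu : (readGaps u).1 = 0 := readGaps_append_fst (by rw [hg])
  have hv : (readGaps v).1 = 0 := readGaps_append_fst (by rw [hh])
  rw [readGaps_append _ _ hv, Prod.mk.injEq] at hg
  rw [readGaps_append _ _ hu, Prod.mk.injEq] at hh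
  have hrot : List.ofFn h = (List.ofFn g).rotate (readGaps u).2.length := by
    rw [← hg.2, ← hh.2, List.rotate_append_length_eq]
  refine ⟨Fin.ofNat k (readGaps u).2.length, fun j => ?_⟩
  have hj : (List.ofFn fun i => g (i + Fin.ofNat k (readGaps u).2.length)) = List.ofFn h := by
    rw [ofFn_add_right, hrot, Fin.val_ofNat]
    conv_rhs => rw [← List.rotate_mod, List.length_ofFn]
  exact congrFun (List.ofFn_injective hj) j

/-! ### The two sequences -/

/-- The entries of `xSeq` as natural numbers. -/
def xGap (i : Fin 12) : ℕ := (xSeq i).toNat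

/-- The entries of `ySeq` as natural numbers. -/
def yGap (i : Fin 12) : ℕ := (ySeq i).toNat

lemma xGap_cast (i : Fin 12) : (xGap i : ℤ) = xSeq i := by
  revert i
  decide

lemma yGap_cast (i : Fin 12) : (yGap i : ℤ) = ySeq i := by
  revert i
  decide

lemma shiftedString_xSeq (n : ℕ) : shiftedString n xSeq = gapString fun i => n + xGap i := by
  unfold shiftedString
  congr 1
  funext i
  rw [← xGap_cast]
  omega

lemma shiftedString_ySeq (n : ℕ) : shiftedString n ySeq = gapString fun i => n + yGap i := by
  unfold shiftedString
  congr 1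
  funext i
  rw [← yGap_cast]
  omega

lemma cyclicallyDistinct_xSeq_ySeq : CyclicallyDistinct xSeq ySeq := by
  unfold CyclicallyDistinct IsCyclicShift
  decide +kernel

lemma isPermutationOf_ySeq_xSeq : IsPermutationOf ySeq xSeq :=
  ⟨Equiv.ofBijective ![2, 4, 0, 5, 1, 3, 8, 10, 6, 11, 7, 9] (by decide +kernel), by
    simp only [Equiv.ofBijective_apply]
    decide +kernel⟩

lemma sameCyclicStats_xSeq_ySeq : SameCyclicStats 4 xSeq ySeq := by
  have h1 : ∀ a : Fin 12, ∑ j, xSeq (a + j) = ∑ j, ySeq (a + j) := by decide +kernel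
  have h2 : ∀ a b : Fin 12, ∑ j, xSeq (a + j) * xSeq (b + j) =
      ∑ j, ySeq (a + j) * ySeq (b + j) := by decide +kernel
  have h3 : ∀ a b c : Fin 12, ∑ j, xSeq (a + j) * xSeq (b + j) * xSeq (c + j) =
      ∑ j, ySeq (a + j) * ySeq (b + j) * ySeq (c + j) := by decide +kernel
  -- By translation invariance one of the four indices may be taken to be zero, leaving `12^3` cases
  -- to evaluate in place of `12^4`.
  have h4 : ∀ a b c : Fin 12, ∑ j, xSeq j * xSeq (a + j) * xSeq (b + j) * xSeq (c + j) =
      ∑ j, ySeq j * ySeq (a + j) * ySeq (b + j) * ySeq (c + j) := by decide +kernel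
  have shift (z : Fin 12 → ℤ) (a b c d : Fin 12) :
      ∑ j, z (a + j) * z (b + j) * z (c + j) * z (d + j) =
        ∑ j, z j * z (b - a + j) * z (c - a + j) * z (d - a + j) := by
    conv_rhs => rw [← Equiv.sum_comp (Equiv.addLeft a)]
    simp only [Equiv.coe_addLeft, ← add_assoc, sub_add_cancel]
  intro m hm i
  unfold cyclicStat
  interval_cases m
  · simp
  · simpa using h1 (i 0)
  · simpa only [Fin.prod_univ_two] using h2 (i 0) (i 1)
  · simpa only [Fin.prod_univ_three] using h3 (i 0) (i 1) (i 2)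
  · simp only [Fin.prod_univ_four]
    rw [shift, shift, h4]

/-- The expansion is in powers of `3 - x`, and `v ↦ 3 - v` exchanges the two sequences, so the
hypothesis is the same equality reversed. -/
lemma sameCyclicStats_gaps :
    SameCyclicStats 4 (fun i => 3 - (xGap i : ℤ)) fun i => 3 - (yGap i : ℤ) := by
  have hx : (fun i => 3 - (xGap i : ℤ)) = ySeq := by
    funext i
    rw [xGap_cast, ySeq]
  have hy : (fun i => 3 - (yGap i : ℤ)) = xSeq := by
    funext i
    rw [yGap_cast, ySeq, sub_sub_cancel]
  rw [hx, hy]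
  exact fun m hm i => (sameCyclicStats_xSeq_ySeq m hm i).symm

lemma not_isRotated_shiftedString (n : ℕ) :
    ¬ (shiftedString n xSeq).IsRotated (shiftedString n ySeq) := by
  intro hr
  rw [shiftedString_xSeq, shiftedString_ySeq] at hr
  obtain ⟨c, hc⟩ := exists_shift_of_isRotated hr.symm
  refine cyclicallyDistinct_xSeq_ySeq ⟨c, fun j => ?_⟩
  rw [← xGap_cast, ← yGap_cast]
  have := hc j
  omega

lemma length_shiftedString_xSeq (n : ℕ) : (shiftedString n xSeq).length = 12 * n + 30 := by
  rw [shiftedString_xSeq, length_gapString, Finset.sum_add_distrib,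
    show ∑ i, xGap i = 18 by decide]
  simp only [Finset.sum_const, Finset.card_univ, Fintype.card_fin, smul_eq_mul]
  omega

lemma length_shiftedString_ySeq (n : ℕ) : (shiftedString n ySeq).length = 12 * n + 30 := by
  rw [shiftedString_ySeq, length_gapString, Finset.sum_add_distrib,
    show ∑ i, yGap i = 18 by decide]
  simp only [Finset.sum_const, Finset.card_univ, Fintype.card_fin, smul_eq_mul]
  omega

/-! ### Lower bounds on the number of traces -/

lemma toOuterMeasure_le_third {α : Type*} (μ : PMF α) {E F : Set α} (hd : Disjoint E F)
    (hF : 2 / 3 ≤ μ.toOuterMeasure F) : μ.toOuterMeasure E ≤ 1 / 3 := by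
  have h : μ.toOuterMeasure E + μ.toOuterMeasure F ≤ 1 := by
    rw [PMF.toOuterMeasure_apply, PMF.toOuterMeasure_apply, ← ENNReal.tsum_add, ← μ.tsum_coe]
    refine ENNReal.tsum_le_tsum fun a => ?_
    by_cases ha : a ∈ E
    · simp [ha, hd.notMem_of_mem_left ha]
    · rw [Set.indicator_of_notMem ha, zero_add]
      exact Set.indicator_le_self _ _ _
  have h3 : (1 / 3 : ℝ≥0∞) + 2 / 3 = 1 := by
    rw [ENNReal.div_add_div_same, show (1 + 2 : ℝ≥0∞) = 3 by norm_num,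
      ENNReal.div_self (by simp) (by simp)]
  refine (ENNReal.add_le_add_iff_right (a := 2 / 3) (by
    exact (ENNReal.div_lt_top (by simp) (by simp)).ne)).1 ?_
  rw [h3]
  exact (add_le_add_right hF _).trans h

/-- Disjoint acceptance sets cover both tasks: singletons for distinguishing, rotation classes for
reconstruction. -/
lemma exists_trace_lower_bound_shiftedString (p : unitInterval) (hp0 : 0 < p) (hp1 : p < 1) :
    ∃ c : ℝ, 0 < c ∧ ∃ n₀ : ℕ, ∀ n : ℕ, n₀ ≤ n → ∀ (T : ℕ) (A : Algorithm T)
      (E F : Set (List Bool)), Disjoint E F →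
      2 / 3 ≤ (A.output p (shiftedString n xSeq)).toOuterMeasure E →
      2 / 3 ≤ (A.output p (shiftedString n ySeq)).toOuterMeasure F →
      c * ((n : ℝ) ^ 5 / Real.log n ^ 5) ≤ T := by
  obtain ⟨c, hc, n₀, h⟩ := exists_trace_lower_bound p hp0 hp1 xGap yGap (by decide) (by decide)
    sameCyclicStats_gaps
  refine ⟨c, hc, n₀, fun n hn T A E F hd hE hF => h n hn T A E ?_ ?_⟩
  · rwa [← shiftedString_xSeq]
  · rw [← shiftedString_ySeq]
    exact toOuterMeasure_le_third _ hd hF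

lemma exists_lower_bound_distinguishes (p : unitInterval) (hp0 : 0 < p) (hp1 : p < 1) :
    ∃ c : ℝ, 0 < c ∧ ∃ n₀ : ℕ, ∀ n : ℕ, n₀ ≤ n → ∀ (T : ℕ) (A : Algorithm T),
      Distinguishes A p (shiftedString n xSeq) (shiftedString n ySeq) →
      c * ((n : ℝ) ^ 5 / Real.log n ^ 5) ≤ T := by
  obtain ⟨c, hc, n₀, h⟩ := exists_trace_lower_bound_shiftedString p hp0 hp1
  refine ⟨c, hc, n₀, fun n hn T A hA => h n hn T A {shiftedString n xSeq} {shiftedString n ySeq}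
    ?_ ?_ ?_⟩
  · rw [Set.disjoint_singleton]
    intro e
    exact not_isRotated_shiftedString n (e ▸ List.IsRotated.refl _)
  · rw [PMF.toOuterMeasure_apply_singleton]
    exact (hA _).1 (List.IsRotated.refl _)
  · rw [PMF.toOuterMeasure_apply_singleton]
    exact (hA _).2 (List.IsRotated.refl _)

lemma exists_lower_bound_reconstruction (p : unitInterval) (hp0 : 0 < p) (hp1 : p < 1) :
    ∃ c : ℝ, 0 < c ∧ ∃ N₀ : ℕ, ∀ N : ℕ, N₀ ≤ N → N % 12 = 6 → ∀ (T : ℕ) (A : Algorithm T),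
      SolvesReconstruction A p N → c * ((N : ℝ) ^ 5 / Real.log N ^ 5) ≤ T := by
  obtain ⟨c, hc, n₀, h⟩ := exists_trace_lower_bound_shiftedString p hp0 hp1
  -- `12n + 30 ≤ 42n` for `n ≥ 1`, and `N ≥ 12n₀ + 54` forces `n ≥ n₀ + 2`, so that `log n > 0`.
  refine ⟨c / 42 ^ 5, by positivity, 12 * n₀ + 54, fun N hN hmod T A hA => ?_⟩
  obtain ⟨n, rfl⟩ : ∃ n, N = 12 * n + 30 := ⟨(N - 30) / 12, by omega⟩
  have hbound := h n (by omega) T A {w | w.IsRotated (shiftedString n xSeq)}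
    {w | w.IsRotated (shiftedString n ySeq)}
    (Set.disjoint_left.2 fun w hx hy => not_isRotated_shiftedString n
      ((List.IsRotated.symm hx).trans hy))
    (hA _ (length_shiftedString_xSeq n)) (hA _ (length_shiftedString_ySeq n))
  refine le_trans ?_ hbound
  have hn : (2 : ℝ) ≤ n := by exact_mod_cast (show 2 ≤ n by omega)
  have hlog : 0 < Real.log n := Real.log_pos (by linarith)
  have hlog' : Real.log n ≤ Real.log (12 * n + 30 : ℕ) :=
    Real.log_le_log (by linarith) (by push_cast; linarith)
  calc c / 42 ^ 5 * (((12 * n + 30 : ℕ) : ℝ) ^ 5 / Real.log (12 * n + 30 : ℕ) ^ 5)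
      ≤ c / 42 ^ 5 * ((42 * n) ^ 5 / Real.log n ^ 5) := by
        gcongr
        push_cast
        linarith
    _ = c * ((n : ℝ) ^ 5 / Real.log n ^ 5) := by
        field_simp

end CircularTrace

theorem mainTheorem4 :
    -- the two sequences of length 12
    CircularTrace.IsPermutationOf CircularTrace.ySeq CircularTrace.xSeq ∧
    CircularTrace.CyclicallyDistinct CircularTrace.xSeq CircularTrace.ySeq ∧
    CircularTrace.SameCyclicStats 4 CircularTrace.xSeq CircularTrace.ySeq ∧
    -- the corresponding strings: same length, cyclically distinct
    (∀ n : ℕ,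
      (CircularTrace.shiftedString n CircularTrace.xSeq).length = 12 * n + 30 ∧
      (CircularTrace.shiftedString n CircularTrace.ySeq).length = 12 * n + 30 ∧
      ¬ (CircularTrace.shiftedString n CircularTrace.xSeq).IsRotated
          (CircularTrace.shiftedString n CircularTrace.ySeq)) ∧
    -- distinguishing them takes `Ω(n^5 / log^5 n)` traces
    (∀ p : unitInterval, 0 < p → p < 1 →
      ∃ c : ℝ, 0 < c ∧ ∃ n₀ : ℕ, ∀ n : ℕ, n₀ ≤ n →
        ∀ (T : ℕ) (A : CircularTrace.Algorithm T),
          CircularTrace.Distinguishes A p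
            (CircularTrace.shiftedString n CircularTrace.xSeq)
            (CircularTrace.shiftedString n CircularTrace.ySeq) →
          c * ((n : ℝ) ^ 5 / Real.log n ^ 5) ≤ (T : ℝ)) ∧
    -- hence circular trace reconstruction of strings of length `N` takes `Ω(N^5 / log^5 N)` traces,
    -- for all large `N` of the form `12 n + 30`
    (∀ p : unitInterval, 0 < p → p < 1 →
      ∃ c : ℝ, 0 < c ∧ ∃ N₀ : ℕ, ∀ N : ℕ, N₀ ≤ N → N % 12 = 6 →
        ∀ (T : ℕ) (A : CircularTrace.Algorithm T),
          CircularTrace.SolvesReconstruction A p N →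
          c * ((N : ℝ) ^ 5 / Real.log N ^ 5) ≤ (T : ℝ)) :=
  ⟨CircularTrace.isPermutationOf_ySeq_xSeq, CircularTrace.cyclicallyDistinct_xSeq_ySeq,
    CircularTrace.sameCyclicStats_xSeq_ySeq,
    fun n => ⟨CircularTrace.length_shiftedString_xSeq n, CircularTrace.length_shiftedString_ySeq n,
      CircularTrace.not_isRotated_shiftedString n⟩,
    CircularTrace.exists_lower_bound_distinguishes,
    CircularTrace.exists_lower_bound_reconstruction⟩
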